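/- Let $n\ge 1$, let $\Omega\subset S^{n-1}$ be a closed set that is not contained in any closed hemisphere of the unit sphere $S^{n-1}\subset\mathbb R^n$, let $h_0:\Omega\to(0,\infty)$ and $f:\Omega\to\mathbb R$ be continuous, and let $\delta_0>0$. Suppose that for each $t\in(-\delta_0,\delta_0)$ the function $h_t:\Omega\to(0,\infty)$ is given by $$h_t(v)=h_0(v)+t f(v)+o(t,v),\qquad v\in\Omega,$$ where $o(t,\cdot)$ is continuous on $\Omega$ and $\lim_{t\to0}o(t,v)/t=0$ uniformly in $v\in\Omega$. For $h:\Omega\to(0,\infty)$ let $[h]=\{x\in\mathbb R^n: x\cdot v\le h(v)\text{ for all }v\in\Omega\}$ be its Wulff shape, and let $V$ denote volume (Lebesgue measure) in $\mathbb R^n$. For a convex body $K$, with support function $h_K(v)=\max_{x\in K}x\cdot v$, let $\partial' K$ be the set of those $x\in\partial K$ for which there is exactly one $v\in S^{n-1}$ with $x\cdot v=h_K(v)$, let $\nu_K(x)$ be this $v$, and let $S(K,\cdot)$ be the surface area measure, that is, the Borel measure $S(K,\eta)=\mathcal H^{n-1}(\nu_K^{-1}(\eta))$ on $S^{n-1}$,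 where $\mathcal H^{n-1}$ is the $(n-1)$-dimensional Hausdorff measure (normalized to agree with Lebesgue measure on $\mathbb R^{n-1}$). Then $f$ is integrable on $\Omega$ with respect to $S([h_0],\cdot)$, and $$\lim_{t\to0}\frac{V([h_t])-V([h_0])}{t}=\int_\Omega f(v)\,dS([h_0],v).$$ -/

import Mathlib

open MeasureTheory Filter Topology
open scoped RealInnerProductSpace

namespace WulffShape

/-- The closed hemisphere of the unit sphere of `ℝⁿ` with centre `u`. -/
def closedHemisphere {n : ℕ} (u : Metric.sphere (0 : EuclideanSpace ℝ (Fin n)) 1) :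
    Set (Metric.sphere (0 : EuclideanSpace ℝ (Fin n)) 1) :=
  {v | 0 ≤ ⟪(u : EuclideanSpace ℝ (Fin n)), (v : EuclideanSpace ℝ (Fin n))⟫}

/-- The Wulff shape `{x ∈ ℝⁿ : x · v ≤ h(v) for all v ∈ Ω}`. Only the values of `h` on `Ω`
matter. -/
def wulffShape {n : ℕ} (Ω : Set (Metric.sphere (0 : EuclideanSpace ℝ (Fin n)) 1))
    (h : Metric.sphere (0 : EuclideanSpace ℝ (Fin n)) 1 → ℝ) : Set (EuclideanSpace ℝ (Fin n)) :=
  {x | ∀ v ∈ Ω, ⟪x, (v : EuclideanSpace ℝ (Fin n))⟫ ≤ h v}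

/-- The support function `h_K(v) = max {x · v : x ∈ K}` of a nonempty compact set `K`. -/
noncomputable def supportFunction {n : ℕ} (K : Set (EuclideanSpace ℝ (Fin n)))
    (v : EuclideanSpace ℝ (Fin n)) : ℝ :=
  sSup ((fun x => ⟪x, v⟫) '' K)

/-- The supporting hyperplane `H_K(v) = {x : x · v = h_K(v)}` of `K` with outer unit normal `v`. -/
def supportHyperplane {n : ℕ} (K : Set (EuclideanSpace ℝ (Fin n)))
    (v : EuclideanSpace ℝ (Fin n)) : Set (EuclideanSpace ℝ (Fin n)) :=
  {x | ⟪x, v⟫ = supportFunction K v}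

/-- The set `∂'K` of the boundary points of `K` that have a unique outer unit normal. -/
def regularBoundary {n : ℕ} (K : Set (EuclideanSpace ℝ (Fin n))) :
    Set (EuclideanSpace ℝ (Fin n)) :=
  {x ∈ frontier K | ∃! v : Metric.sphere (0 : EuclideanSpace ℝ (Fin n)) 1,
    x ∈ supportHyperplane K v}

/-- The Gauss map `ν_K : ∂'K → Sⁿ⁻¹`. -/
noncomputable def gaussMap {n : ℕ} (K : Set (EuclideanSpace ℝ (Fin n)))
    (x : regularBoundary K) : Metric.sphere (0 : EuclideanSpace ℝ (Fin n)) 1 :=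
  x.2.2.choose

/-- The surface area measure `S(K, η) = ℋⁿ⁻¹(ν_K⁻¹(η))` of a convex body `K` in `ℝⁿ`, `n ≥ 1`.
Here `μHE[n - 1]` is the Hausdorff measure in its usual normalization, in which it coincides
with Lebesgue measure on `ℝⁿ⁻¹`; it is taken on the metric subspace `∂'K` of `ℝⁿ`. The formula
for all Borel sets `η` is `surfaceAreaMeasure_apply` below. -/
noncomputable def surfaceAreaMeasure {n : ℕ} (K : Set (EuclideanSpace ℝ (Fin n))) :
    Measure (Metric.sphere (0 : EuclideanSpace ℝ (Fin n)) 1) :=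
  Measure.map (gaussMap K) (μHE[n - 1] : Measure (regularBoundary K))

theorem mem_supportHyperplane_gaussMap {n : ℕ} (K : Set (EuclideanSpace ℝ (Fin n)))
    (x : regularBoundary K) :
    (x : EuclideanSpace ℝ (Fin n)) ∈ supportHyperplane K (gaussMap K x) :=
  x.2.2.choose_spec.1

theorem eq_gaussMap {n : ℕ} (K : Set (EuclideanSpace ℝ (Fin n))) (x : regularBoundary K)
    (v : Metric.sphere (0 : EuclideanSpace ℝ (Fin n)) 1)
    (hv : (x : EuclideanSpace ℝ (Fin n)) ∈ supportHyperplane K v) : v = gaussMap K x :=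
  x.2.2.choose_spec.2 v hv

theorem mem_supportHyperplane_iff {n : ℕ} {K : Set (EuclideanSpace ℝ (Fin n))} (hK : IsCompact K)
    {x : EuclideanSpace ℝ (Fin n)} (hx : x ∈ K) (v : EuclideanSpace ℝ (Fin n)) :
    x ∈ supportHyperplane K v ↔ ∀ y ∈ K, ⟪y, v⟫ ≤ ⟪x, v⟫ := by
  have hb : BddAbove ((fun x => ⟪x, v⟫) '' K) :=
    (hK.image (by fun_prop)).bddAbove
  constructor
  · intro h y hy
    have h' : ⟪x, v⟫ = sSup ((fun x => ⟪x, v⟫) '' K) := h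
    rw [h']
    exact le_csSup hb ⟨y, hy, rfl⟩
  · intro h
    refine le_antisymm (le_csSup hb ⟨x, hx, rfl⟩) (csSup_le ⟨_, x, hx, rfl⟩ ?_)
    rintro _ ⟨y, hy, rfl⟩
    exact h y hy

theorem continuous_gaussMap {n : ℕ} {K : Set (EuclideanSpace ℝ (Fin n))} (hK : IsCompact K) :
    Continuous (gaussMap K) := by
  have hmem : ∀ x : regularBoundary K, (x : EuclideanSpace ℝ (Fin n)) ∈ K := fun x =>
    hK.isClosed.frontier_subset x.2.1
  rw [continuous_iff_isClosed]
  intro C hC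
  have hG : IsClosed {p : regularBoundary K × Metric.sphere (0 : EuclideanSpace ℝ (Fin n)) 1 |
      ∀ y ∈ K, ⟪y, (p.2 : EuclideanSpace ℝ (Fin n))⟫ ≤
        ⟪(p.1 : EuclideanSpace ℝ (Fin n)), (p.2 : EuclideanSpace ℝ (Fin n))⟫} := by
    simp only [Set.ofPred_forall]
    exact isClosed_biInter fun y _ => isClosed_le (by fun_prop) (by fun_prop)
  have hE := isClosedMap_fst_of_compactSpace _ (hG.inter (hC.preimage continuous_snd))
  convert hE using 1
  ext x
  constructor
  · intro hx
    exact ⟨(x, gaussMap K x), ⟨(mem_supportHyperplane_iff hK (hmem x) _).1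
      (mem_supportHyperplane_gaussMap K x), hx⟩, rfl⟩
  · rintro ⟨⟨x', v⟩, ⟨h1, h2⟩, rfl⟩
    have := eq_gaussMap K x' v ((mem_supportHyperplane_iff hK (hmem x') _).2 h1)
    simpa [← this] using h2

/-- `S(K, η) = ℋⁿ⁻¹(ν_K⁻¹(η))` for every Borel set `η` of the sphere. -/
theorem surfaceAreaMeasure_apply {n : ℕ} {K : Set (EuclideanSpace ℝ (Fin n))} (hK : IsCompact K)
    {η : Set (Metric.sphere (0 : EuclideanSpace ℝ (Fin n)) 1)} (hη : MeasurableSet η) :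
    surfaceAreaMeasure K η =
      μHE[n - 1] (((↑) : regularBoundary K → EuclideanSpace ℝ (Fin n)) '' (gaussMap K ⁻¹' η)) := by
  rw [surfaceAreaMeasure, Measure.map_apply (continuous_gaussMap hK).measurable hη,
    isometry_subtype_coe.euclideanHausdorffMeasure_image]

end WulffShape

/-! Write K = [h₀], with gauge g, and g_t for the gauge of [h_t]. Polar coordinates give V([h_t]) =
∫_K (g / g_t)ⁿ dx (`volume_sublevel_eq_lintegral`), so the moving domain becomes a moving integrand
on the fixed body K.

On each ray, the ratio q_t = g / g_t is squeezed between h_t / h₀ at a constraint active for h_t and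
h_t / h₀ at one active for h₀ (`le_gauge_div_gauge`, `gauge_div_gauge_le`). If the ray meets ∂K in a
regular point z, only ν(z) is active for h₀ there. By compactness of Ω the active directions for h_t
converge to ν(z), so q_t has derivative (f / h₀)(ν(z)) at t = 0. The gauge is Lipschitz, so by
Rademacher's theorem almost every ray is of this kind. The squeeze also bounds |q_t - 1| / |t|
uniformly, and dominated convergence yields the derivative ∫_K n (f / h₀)(ν(π x)) dx, where π is the
radial projection to ∂'K.

It remains to recognise this as ∫ f dS. The image of Lebesgue measure on K under π is the cone
measure; multiplied by n / (z · ν(z)) it is ℋⁿ⁻¹ on ∂'K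
(`euclideanHausdorffMeasure_regularBoundary`), and z · ν(z) = h₀(ν(z)) by `gaussMap_wulffShape`. The
identity of measures is local: near a regular point, central projection to the tangent hyperplane is
bi-Lipschitz with constant c close to 1, and for cones over pieces of a hyperplane it follows by
slicing. This gives both inequalities up to c²ⁿ, and c tends to 1. -/

namespace WulffShape

open scoped Pointwise ENNReal NNReal
open Set Module

/-! ### Cones over flat pieces, and volume in polar coordinates -/

section

/-- A locally verified inequality between measures is global. -/
theorem measure_le_of_locally_le {X : Type*} [TopologicalSpace X] [SecondCountableTopology X]
    [MeasurableSpace X] [OpensMeasurableSpace X] {μ ν : Measure X}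
    (h : ∀ x, ∃ U, IsOpen U ∧ x ∈ U ∧ ∀ A, MeasurableSet A → A ⊆ U → μ A ≤ ν A) : μ ≤ ν := by
  choose U hUo hxU hU using h
  obtain ⟨s, hs, hcov⟩ := TopologicalSpace.countable_cover_nhds
    (f := U) (fun x => (hUo x).mem_nhds (hxU x))
  rcases s.eq_empty_or_nonempty with rfl | hne
  · have : IsEmpty X := by
      rw [← Set.univ_eq_empty_iff, ← hcov]; simp
    exact Measure.le_iff.2 fun A _ => by simp [Set.eq_empty_of_isEmpty A]
  obtain ⟨e, rfl⟩ := hs.exists_eq_range hne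
  have hcov' : ⋃ i, U (e i) = univ := by simpa using hcov
  refine Measure.le_iff.2 fun A hA => ?_
  have hm : ∀ i, MeasurableSet (disjointed (fun i => U (e i)) i) :=
    MeasurableSet.disjointed fun i => (hUo _).measurableSet
  have hA' : A = ⋃ i, A ∩ disjointed (fun i => U (e i)) i := by
    rw [← inter_iUnion, iUnion_disjointed, hcov', inter_univ]
  have hd : Pairwise (Function.onFun Disjoint fun i => A ∩ disjointed (fun i => U (e i)) i) :=
    fun i j hij => ((disjoint_disjointed _) hij).mono inter_subset_right inter_subset_right
  rw [hA', measure_iUnion hd fun i => hA.inter (hm i),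
    measure_iUnion hd fun i => hA.inter (hm i)]
  exact ENNReal.tsum_le_tsum fun i => hU (e i) _ (hA.inter (hm i))
    (inter_subset_right.trans (disjointed_subset _ _))

variable {n : ℕ}

/-- The volume of a cone with apex the origin over a subset of a hyperplane. -/
theorem volume_cone_of_subset_hyperplane (hn : 1 ≤ n) {v : EuclideanSpace ℝ (Fin n)}
    (hv : ‖v‖ = 1) {h : ℝ} (hh : 0 < h) {B : Set (EuclideanSpace ℝ (Fin n))}
    (hB : MeasurableSet B) (hBv : ∀ x ∈ B, ⟪x, v⟫ = h) :
    volume (Ioc (0 : ℝ) 1 • B) = ENNReal.ofReal (h / n) * μHE[n - 1] B := by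
  have hv0 : v ≠ 0 := by rintro rfl; simp at hv
  -- As a slab intersected with the preimage of B under central projection, the cone is visibly
  -- measurable, which slicing requires.
  have hcone : Ioc (0 : ℝ) 1 • B =
      {x | ⟪x, v⟫ ∈ Ioc (0 : ℝ) h} ∩ (fun x => (h / ⟪x, v⟫) • x) ⁻¹' B := by
    ext x
    constructor
    · rintro ⟨s, hs, b, hb, rfl⟩
      have h1 : ⟪s • b, v⟫ = s * h := by rw [real_inner_smul_left, hBv b hb]
      refine ⟨?_, ?_⟩
      · simp only [mem_ofPred_eq, h1]
        exact ⟨mul_pos hs.1 hh, by nlinarith [hs.2]⟩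
      · simp only [mem_preimage, h1, smul_smul]
        have : h / (s * h) * s = 1 := by have := hs.1; field_simp
        rwa [this, one_smul]
    · rintro ⟨⟨h1, h2⟩, h3⟩
      refine ⟨⟪x, v⟫ / h, ⟨by positivity, by rwa [div_le_one hh]⟩, _, h3, ?_⟩
      simp only [smul_smul]
      rw [div_mul_div_cancel₀ hh.ne', div_self h1.ne', one_smul]
  have hmeas : MeasurableSet (Ioc (0 : ℝ) 1 • B) := by
    rw [hcone]
    refine MeasurableSet.inter ?_ ?_
    · exact (by fun_prop : Measurable fun x : EuclideanSpace ℝ (Fin n) => ⟪x, v⟫) measurableSet_Ioc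
    · exact (by fun_prop : Measurable fun x : EuclideanSpace ℝ (Fin n) =>
        (h / ⟪x, v⟫) • x) hB
  have key := EuclideanGeometry.euclideanHausdorffMeasure_eq_lintegral
    (0 : EuclideanSpace ℝ (Fin n)) hv0 hmeas
  simp only [finrank_euclideanSpace, Fintype.card_fin] at key
  rw [EuclideanSpace.euclideanHausdorffMeasure_eq_volume] at key
  -- The slice at height s is the homothetic copy (s / h) • B. The factor (s / h) ^ (n - 1)
  -- integrates to h / n over (0, h].
  have hslice : ∀ s : ℝ, μHE[n - 1] ((Ioc (0 : ℝ) 1 • B) ∩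
      (AffineSubspace.mk' (s • v +ᵥ (0 : EuclideanSpace ℝ (Fin n))) (ℝ ∙ v)ᗮ :
        Set (EuclideanSpace ℝ (Fin n)))) =
      (Ioc 0 h).indicator (fun s => ENNReal.ofReal ((s / h) ^ (n - 1)) * μHE[n - 1] B) s := by
    intro s
    have hmem : ∀ x : EuclideanSpace ℝ (Fin n),
        x ∈ AffineSubspace.mk' (s • v +ᵥ (0 : EuclideanSpace ℝ (Fin n))) (ℝ ∙ v)ᗮ ↔
          ⟪x, v⟫ = s := by
      intro x
      rw [AffineSubspace.mem_mk', Submodule.mem_orthogonal_singleton_iff_inner_left]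
      simp [inner_sub_left, real_inner_smul_left, hv, sub_eq_zero]
    by_cases hs : s ∈ Ioc 0 h
    · rw [indicator_of_mem hs]
      have : (Ioc (0 : ℝ) 1 • B) ∩
          (AffineSubspace.mk' (s • v +ᵥ (0 : EuclideanSpace ℝ (Fin n))) (ℝ ∙ v)ᗮ :
          Set (EuclideanSpace ℝ (Fin n))) = (s / h) • B := by
        ext x
        rw [mem_inter_iff, SetLike.mem_coe, hmem]
        constructor
        · rintro ⟨⟨r, hr, b, hb, rfl⟩, h2⟩
          simp only [real_inner_smul_left, hBv b hb] at h2
          refine ⟨b, hb, ?_⟩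
          simp only [← h2]
          rw [mul_div_assoc, div_self hh.ne', mul_one]
        · rintro ⟨b, hb, rfl⟩
          refine ⟨⟨s / h, ⟨div_pos hs.1 hh, by rw [div_le_one hh]; exact hs.2⟩, b, hb, rfl⟩, ?_⟩
          simp only [real_inner_smul_left, hBv b hb]
          field_simp
      rw [this, Measure.euclideanHausdorffMeasure_smul₀ _ (div_pos hs.1 hh).ne',
        ENNReal.smul_def, smul_eq_mul]
      congr 1
      rw [ENNReal.ofReal_pow (div_pos hs.1 hh).le, ENNReal.coe_pow,
        ← Real.enorm_eq_ofReal (div_pos hs.1 hh).le]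
      rfl
    · rw [indicator_of_notMem hs]
      convert measure_empty (μ := (μHE[n - 1] : Measure (EuclideanSpace ℝ (Fin n)))) using 2
      ext x
      simp only [mem_inter_iff, SetLike.mem_coe, hmem, mem_empty_iff_false, iff_false]
      rintro ⟨hx, hx2⟩
      rw [hcone] at hx
      exact hs (hx2 ▸ hx.1)
  rw [key]
  simp only [hslice]
  have hve : ‖v‖ₑ = 1 := by rw [← ofReal_norm, hv, ENNReal.ofReal_one]
  rw [hve, one_mul, lintegral_indicator measurableSet_Ioc,
    lintegral_mul_const _ (by fun_prop), ← ofReal_integral_eq_lintegral_ofReal]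
  · congr 2
    rw [← intervalIntegral.integral_of_le hh.le]
    obtain ⟨m, rfl⟩ : ∃ m, n = m + 1 := ⟨n - 1, by omega⟩
    simp only [div_pow, Nat.add_sub_cancel]
    rw [intervalIntegral.integral_div, integral_pow]
    push_cast
    field_simp
    simp [pow_succ]
  · exact (Continuous.integrableOn_Icc (by fun_prop)).mono_set Ioc_subset_Icc_self
  · filter_upwards [ae_restrict_mem measurableSet_Ioc] with s hs
    exact pow_nonneg (div_nonneg hs.1.le hh.le) _

theorem volumeIoiPow_Iic (m : ℕ) (x : Ioi (0 : ℝ)) :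
    Measure.volumeIoiPow m (Iic x) = ENNReal.ofReal (x.1 ^ (m + 1) / (m + 1)) := by
  rw [← Measure.volumeIoiPow_apply_Iio]
  have h0 : Measure.volumeIoiPow m {x} = 0 := by
    rw [Measure.volumeIoiPow]
    refine withDensity_absolutelyContinuous _ _ ?_
    rw [Measure.comap_apply _ Subtype.val_injective (fun s hs => measurableSet_Ioi.subtype_image hs) _
      (measurableSet_singleton _)]
    simp
  rw [← Iio_union_right]
  refine le_antisymm ?_ (measure_mono subset_union_left)
  exact (measure_union_le _ _).trans (by rw [h0, add_zero])

/-- Polar coordinates: integration of a function that is constant on rays over a star body. -/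
theorem lintegral_sublevel_eq_lintegral_sphere (hn : 1 ≤ n) {g : EuclideanSpace ℝ (Fin n) → ℝ}
    (hg : Measurable g) (hg_hom : ∀ r : ℝ, 0 < r → ∀ x, g (r • x) = r * g x)
    (hg_pos : ∀ x, x ≠ 0 → 0 < g x) {φ : EuclideanSpace ℝ (Fin n) → ℝ≥0∞}
    (hφ : Measurable φ) (hφ_hom : ∀ r : ℝ, 0 < r → ∀ x, φ (r • x) = φ x) :
    ∫⁻ x in {x | g x ≤ 1}, φ x =
      ∫⁻ u : Metric.sphere (0 : EuclideanSpace ℝ (Fin n)) 1,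
        φ u * ENNReal.ofReal ((g u)⁻¹ ^ n / n) ∂(volume : Measure _).toSphere := by
  have : Nonempty (Fin n) := ⟨⟨0, hn⟩⟩
  have hS : MeasurableSet {x | g x ≤ 1} := measurableSet_le hg measurable_const
  let F : EuclideanSpace ℝ (Fin n) → ℝ≥0∞ := {x | g x ≤ 1}.indicator φ
  have hF : Measurable F := hφ.indicator hS
  let G : Metric.sphere (0 : EuclideanSpace ℝ (Fin n)) 1 × Ioi (0 : ℝ) → ℝ≥0∞ :=
    fun p => F (p.2.1 • p.1.1)
  have hG : Measurable G := hF.comp (by fun_prop)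
  calc ∫⁻ x in {x | g x ≤ 1}, φ x = ∫⁻ x, F x := (lintegral_indicator hS _).symm
    _ = ∫⁻ x in ({0}ᶜ : Set (EuclideanSpace ℝ (Fin n))), F x := by
        rw [restrict_compl_singleton]
    _ = ∫⁻ x : ({0}ᶜ : Set (EuclideanSpace ℝ (Fin n))), F x ∂(volume.comap Subtype.val) :=
        (lintegral_subtype_comap (measurableSet_singleton _).compl _).symm
    _ = ∫⁻ x : ({0}ᶜ : Set (EuclideanSpace ℝ (Fin n))),
          G (homeomorphUnitSphereProd _ x) ∂(volume.comap Subtype.val) := by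
        congr with x
        have := congrArg Subtype.val ((homeomorphUnitSphereProd
          (EuclideanSpace ℝ (Fin n))).symm_apply_apply x)
        rw [homeomorphUnitSphereProd_symm_apply_coe] at this
        simp only [G]
        rw [this]
    _ = ∫⁻ p, G p ∂((volume : Measure _).toSphere.prod
          (Measure.volumeIoiPow (finrank ℝ (EuclideanSpace ℝ (Fin n)) - 1))) :=
        (Measure.measurePreserving_homeomorphUnitSphereProd _).lintegral_comp hG
    _ = _ := by
        rw [lintegral_prod _ hG.aemeasurable]
        congr with u
        have hu : 0 < g u := hg_pos _ (by
          have := u.2; intro h; simp [h] at this)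
        -- The ray in direction u meets the body exactly for r ≤ 1 / g u, and φ is constant along
        -- it.
        have : ∀ r : Ioi (0 : ℝ), G (u, r) =
            (Iic (⟨(g u)⁻¹, inv_pos.2 hu⟩ : Ioi (0 : ℝ))).indicator (fun _ => φ u) r := by
          intro r
          simp only [G, F, indicator]
          rw [hφ_hom _ r.2]
          congr 1
          simp only [mem_ofPred_eq, hg_hom _ r.2, mem_Iic, eq_iff_iff, ← Subtype.coe_le_coe]
          rw [inv_eq_one_div, le_div_iff₀ hu]
        simp only [this]
        rw [lintegral_indicator measurableSet_Iic, lintegral_const, Measure.restrict_apply_univ,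
          volumeIoiPow_Iic]
        simp only [finrank_euclideanSpace, Fintype.card_fin, Nat.sub_add_cancel hn]
        congr 3
        rw [Nat.cast_sub hn]; simp

/-- The volume of a star body as an integral over another one. -/
theorem volume_sublevel_eq_lintegral (hn : 1 ≤ n) {g g' : EuclideanSpace ℝ (Fin n) → ℝ}
    (hg : Measurable g) (hg_hom : ∀ r : ℝ, 0 < r → ∀ x, g (r • x) = r * g x)
    (hg_pos : ∀ x, x ≠ 0 → 0 < g x)
    (hg' : Measurable g') (hg_hom' : ∀ r : ℝ, 0 < r → ∀ x, g' (r • x) = r * g' x)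
    (hg_pos' : ∀ x, x ≠ 0 → 0 < g' x) :
    volume {x | g' x ≤ 1} = ∫⁻ x in {x | g x ≤ 1}, ENNReal.ofReal ((g x / g' x) ^ n) := by
  -- The quotient g / g' is constant on rays, so both sides become integrals over the sphere; the
  -- integrands agree because (g / g')ⁿ g⁻ⁿ = g'⁻ⁿ.
  rw [lintegral_sublevel_eq_lintegral_sphere hn hg hg_hom hg_pos (by fun_prop)
    (fun r hr x => by rw [hg_hom r hr, hg_hom' r hr, mul_div_mul_left _ _ hr.ne']),
    ← setLIntegral_one, lintegral_sublevel_eq_lintegral_sphere hn hg' hg_hom' hg_pos' (by fun_prop)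
    (fun _ _ _ => rfl)]
  congr with u
  have h0 : (u : EuclideanSpace ℝ (Fin n)) ≠ 0 := by
    have := u.2; intro h; simp [h] at this
  have h1 := hg_pos _ h0
  have h2 := hg_pos' _ h0
  rw [one_mul, ← ENNReal.ofReal_mul (by positivity)]
  congr 1
  rw [← mul_div_assoc, ← mul_pow]
  congr 2
  field_simp

end

/-! ### Gauges, regular boundary points and central projection -/

section

variable {n : ℕ} {K : Set (EuclideanSpace ℝ (Fin n))}

theorem gauge_pos_of_ne_zero (hK : IsCompact K) (h0 : K ∈ 𝓝 0) {x : EuclideanSpace ℝ (Fin n)}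
    (hx : x ≠ 0) : 0 < gauge K x :=
  (gauge_pos (absorbent_nhds_zero h0) ((NormedSpace.isVonNBounded_iff ℝ).2 hK.isBounded)).2 hx

theorem gauge_smul_of_pos (K : Set (EuclideanSpace ℝ (Fin n))) (r : ℝ) (hr : 0 < r)
    (x : EuclideanSpace ℝ (Fin n)) : gauge K (r • x) = r * gauge K x := by
  rw [gauge_smul_of_nonneg hr.le, smul_eq_mul]

theorem setOf_gauge_le_one (hK : IsCompact K) (hc : Convex ℝ K) (h0 : K ∈ 𝓝 0) :
    {x | gauge K x ≤ 1} = K := by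
  ext x
  rw [mem_ofPred_eq, gauge_le_one_iff_mem_closure hc h0, hK.isClosed.closure_eq]

theorem inv_gauge_smul_mem_frontier (hK : IsCompact K) (hc : Convex ℝ K) (h0 : K ∈ 𝓝 0)
    {x : EuclideanSpace ℝ (Fin n)} (hx : x ≠ 0) : (gauge K x)⁻¹ • x ∈ frontier K := by
  have h := gauge_pos_of_ne_zero hK h0 hx
  rw [← gauge_eq_one_iff_mem_frontier hc h0, gauge_smul_of_pos K _ (inv_pos.2 h),
    inv_mul_cancel₀ h.ne']

theorem inner_le_mul_gauge (hK : IsCompact K) (hc : Convex ℝ K) (h0 : K ∈ 𝓝 0)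
    {v : EuclideanSpace ℝ (Fin n)} {b : ℝ} (hb : ∀ y ∈ K, ⟪y, v⟫ ≤ b)
    (x : EuclideanSpace ℝ (Fin n)) : ⟪x, v⟫ ≤ gauge K x * b := by
  rcases eq_or_ne x 0 with rfl | hx
  · simp
  have h := gauge_pos_of_ne_zero hK h0 hx
  have := hb _ (hK.isClosed.frontier_subset (inv_gauge_smul_mem_frontier hK hc h0 hx))
  rwa [real_inner_smul_left, inv_mul_le_iff₀ h] at this

/-- The support function of a body with the origin in its interior is bounded below. -/
theorem exists_pos_le_inner_of_normal (h0 : K ∈ 𝓝 0) :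
    ∃ r : ℝ, 0 < r ∧ ∀ v : Metric.sphere (0 : EuclideanSpace ℝ (Fin n)) 1, ∀ b : ℝ,
      (∀ y ∈ K, ⟪y, (v : EuclideanSpace ℝ (Fin n))⟫ ≤ b) → r ≤ b := by
  obtain ⟨r, hr, hrK⟩ := Metric.nhds_basis_closedBall.mem_iff.1 h0
  refine ⟨r, hr, fun v b hb => ?_⟩
  have hv : ‖(v : EuclideanSpace ℝ (Fin n))‖ = 1 := by simp
  have := hb (r • (v : EuclideanSpace ℝ (Fin n))) (hrK (by
    simp [norm_smul, hv, abs_of_pos hr]))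
  simpa [real_inner_smul_left, hv] using this

theorem mem_of_mem_regularBoundary (hK : IsCompact K) (x : regularBoundary K) :
    (x : EuclideanSpace ℝ (Fin n)) ∈ K :=
  hK.isClosed.frontier_subset x.2.1

theorem inner_gaussMap_le (hK : IsCompact K) (x : regularBoundary K)
    {y : EuclideanSpace ℝ (Fin n)} (hy : y ∈ K) :
    ⟪y, (gaussMap K x : EuclideanSpace ℝ (Fin n))⟫ ≤
      ⟪(x : EuclideanSpace ℝ (Fin n)), (gaussMap K x : EuclideanSpace ℝ (Fin n))⟫ :=
  (mem_supportHyperplane_iff hK (mem_of_mem_regularBoundary hK x) _).1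
    (mem_supportHyperplane_gaussMap K x) y hy

/-- Where the gauge is differentiable, there is at most one outer unit normal. -/
theorem normal_unique_of_differentiableAt (hK : IsCompact K) (hc : Convex ℝ K) (h0 : K ∈ 𝓝 0)
    {x : EuclideanSpace ℝ (Fin n)} (hd : DifferentiableAt ℝ (gauge K) x)
    {v w : Metric.sphere (0 : EuclideanSpace ℝ (Fin n)) 1} {a b : ℝ}
    (hv : ∀ y ∈ K, ⟪y, (v : EuclideanSpace ℝ (Fin n))⟫ ≤ a)
    (hvx : ⟪x, (v : EuclideanSpace ℝ (Fin n))⟫ = gauge K x * a)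
    (hw : ∀ y ∈ K, ⟪y, (w : EuclideanSpace ℝ (Fin n))⟫ ≤ b)
    (hwx : ⟪x, (w : EuclideanSpace ℝ (Fin n))⟫ = gauge K x * b) : v = w := by
  have key : ∀ (u : Metric.sphere (0 : EuclideanSpace ℝ (Fin n)) 1) (c : ℝ),
      (∀ y ∈ K, ⟪y, (u : EuclideanSpace ℝ (Fin n))⟫ ≤ c) →
      ⟪x, (u : EuclideanSpace ℝ (Fin n))⟫ = gauge K x * c →
      c • fderiv ℝ (gauge K) x = innerSL ℝ (u : EuclideanSpace ℝ (Fin n)) := by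
    intro u c hu hux
    -- The function c · gauge - ⟪u, ·⟫ is nonnegative and vanishes at x. Hence u is c times the
    -- gradient of the gauge, and |u| = 1 then determines c as well as u.
    have hmin : IsLocalMin (fun y => c * gauge K y - innerSL ℝ (u : EuclideanSpace ℝ (Fin n)) y)
        x := by
      refine Filter.Eventually.of_forall fun y => ?_
      simp only [innerSL_apply_apply]
      rw [real_inner_comm x, hux, real_inner_comm y]
      have := inner_le_mul_gauge hK hc h0 hu y
      linarith
    have hder := ((hd.hasFDerivAt.const_mul c).sub
      (innerSL ℝ (u : EuclideanSpace ℝ (Fin n))).hasFDerivAt)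
    exact sub_eq_zero.1 (hmin.hasFDerivAt_eq_zero hder)
  obtain ⟨r, hr, hrK⟩ := exists_pos_le_inner_of_normal h0
  have ha : 0 < a := hr.trans_le (hrK v a hv)
  have hb : 0 < b := hr.trans_le (hrK w b hw)
  have h1 := key v a hv hvx
  have h2 := key w b hw hwx
  have hnv : ‖(v : EuclideanSpace ℝ (Fin n))‖ = 1 := by simp
  have hnw : ‖(w : EuclideanSpace ℝ (Fin n))‖ = 1 := by simp
  have n1 := congrArg norm h1
  have n2 := congrArg norm h2
  rw [norm_smul, innerSL_apply_norm, hnv, Real.norm_of_nonneg ha.le] at n1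
  rw [norm_smul, innerSL_apply_norm, hnw, Real.norm_of_nonneg hb.le] at n2
  have hab : a = b := by
    have : ‖fderiv ℝ (gauge K) x‖ ≠ 0 := fun h => by simp [h] at n1
    exact mul_right_cancel₀ this (n1.trans n2.symm)
  subst hab
  have h3 := h1.symm.trans h2
  refine Subtype.ext (ext_inner_right ℝ fun y => ?_)
  simpa using congrArg (fun L => L y) h3

/-- Almost every ray meets the boundary of a convex body in a regular point. -/
theorem ae_inv_gauge_smul_mem_regularBoundary (hK : IsCompact K) (hc : Convex ℝ K)
    (h0 : K ∈ 𝓝 0)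
    (hs : ∀ x ∈ frontier K, ∃ v : Metric.sphere (0 : EuclideanSpace ℝ (Fin n)) 1,
      x ∈ supportHyperplane K v) :
    ∀ᵐ x : EuclideanSpace ℝ (Fin n), x ≠ 0 → (gauge K x)⁻¹ • x ∈ regularBoundary K := by
  obtain ⟨L, hL⟩ := hc.lipschitz_gauge h0
  -- Rademacher's theorem for the Lipschitz gauge.
  filter_upwards [hL.ae_differentiableAt] with x hd hx
  have hfr := inv_gauge_smul_mem_frontier hK hc h0 hx
  have hmem := hK.isClosed.frontier_subset hfr
  have hg := gauge_pos_of_ne_zero hK h0 hx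
  refine ⟨hfr, existsUnique_of_exists_of_unique (hs _ hfr) fun v w hv hw => ?_⟩
  refine normal_unique_of_differentiableAt hK hc h0 hd
    ((mem_supportHyperplane_iff hK hmem _).1 hv) ?_ ((mem_supportHyperplane_iff hK hmem _).1 hw) ?_
  all_goals rw [real_inner_smul_left, mul_inv_cancel_left₀ hg.ne']

/-- The points with two normals at distance at least 1 / (k + 1) form a closed set, as a projection
along the compact space of pairs of directions. Removing these countably many sets from the boundary
leaves the regular points. -/
theorem measurableSet_regularBoundary (hK : IsCompact K)
    (hs : ∀ x ∈ frontier K, ∃ v : Metric.sphere (0 : EuclideanSpace ℝ (Fin n)) 1,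
      x ∈ supportHyperplane K v) : MeasurableSet (regularBoundary K) := by
  let S := Metric.sphere (0 : EuclideanSpace ℝ (Fin n)) 1
  let C : ℕ → Set (EuclideanSpace ℝ (Fin n) × (S × S)) := fun k =>
    {p | ∀ y ∈ K, ⟪y, (p.2.1 : EuclideanSpace ℝ (Fin n))⟫ ≤
        ⟪p.1, (p.2.1 : EuclideanSpace ℝ (Fin n))⟫} ∩
      ({p | ∀ y ∈ K, ⟪y, (p.2.2 : EuclideanSpace ℝ (Fin n))⟫ ≤
        ⟪p.1, (p.2.2 : EuclideanSpace ℝ (Fin n))⟫} ∩ {p | 1 / ((k : ℝ) + 1) ≤ dist p.2.1 p.2.2})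
  have hC : ∀ k, IsClosed (C k) := by
    intro k
    have hdist : IsClosed {p : EuclideanSpace ℝ (Fin n) × (S × S) |
        1 / ((k : ℝ) + 1) ≤ dist p.2.1 p.2.2} := isClosed_le continuous_const (by fun_prop)
    refine IsClosed.inter ?_ (IsClosed.inter ?_ hdist)
    · simp only [Set.ofPred_forall]
      exact isClosed_biInter fun y _ => isClosed_le (by fun_prop) (by fun_prop)
    · simp only [Set.ofPred_forall]
      exact isClosed_biInter fun y _ => isClosed_le (by fun_prop) (by fun_prop)
  have hE : ∀ k, IsClosed (Prod.fst '' C k) := fun k => isClosedMap_fst_of_compactSpace _ (hC k)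
  have : regularBoundary K = frontier K \ ⋃ k, Prod.fst '' C k := by
    ext x
    constructor
    · rintro ⟨hx, v, hv, hu⟩
      have hxK := hK.isClosed.frontier_subset hx
      refine ⟨hx, ?_⟩
      simp only [mem_iUnion, mem_image, not_exists, not_and]
      rintro k ⟨y, w, w'⟩ ⟨h1, h2, h3⟩ rfl
      have e1 := hu w ((mem_supportHyperplane_iff hK hxK _).2 h1)
      have e2 := hu w' ((mem_supportHyperplane_iff hK hxK _).2 h2)
      simp only [e1, e2, dist_self, mem_ofPred_eq] at h3
      exact absurd h3 (not_le.2 (by positivity))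
    · rintro ⟨hx, hx2⟩
      have hxK := hK.isClosed.frontier_subset hx
      refine ⟨hx, existsUnique_of_exists_of_unique (hs x hx) fun v w hv hw => ?_⟩
      by_contra hne
      obtain ⟨k, hk⟩ := exists_nat_one_div_lt (dist_pos.2 hne)
      exact hx2 (mem_iUnion.2 ⟨k, (x, (v, w)), ⟨(mem_supportHyperplane_iff hK hxK _).1 hv,
        (mem_supportHyperplane_iff hK hxK _).1 hw, hk.le⟩, rfl⟩)
  rw [this]
  exact isClosed_frontier.measurableSet.diff (MeasurableSet.iUnion fun k => (hE k).measurableSet)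

/-- Near a regular point, the central projection of the regular boundary to the tangent hyperplane
is almost an isometry. -/
theorem exists_open_central_projection_near_isometry (hK : IsCompact K) (h0 : K ∈ 𝓝 0)
    (x₀ : regularBoundary K) {c : ℝ} (hc1 : 1 < c) {v : EuclideanSpace ℝ (Fin n)}
    (hv : v = gaussMap K x₀) {h : ℝ} (hh : h = ⟪(x₀ : EuclideanSpace ℝ (Fin n)), v⟫) :
    0 < h ∧ ∃ U : Set (regularBoundary K), IsOpen U ∧ x₀ ∈ U ∧
      (∀ x ∈ U, 0 < ⟪(x : EuclideanSpace ℝ (Fin n)), v⟫ ∧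
        ⟪(x : EuclideanSpace ℝ (Fin n)), v⟫ ≤ c * h ∧
        h ≤ c * ⟪(x : EuclideanSpace ℝ (Fin n)), v⟫ ∧
        ⟪(x : EuclideanSpace ℝ (Fin n)), (gaussMap K x : EuclideanSpace ℝ (Fin n))⟫ ≤ c * h ∧
        h ≤ c * ⟪(x : EuclideanSpace ℝ (Fin n)), (gaussMap K x : EuclideanSpace ℝ (Fin n))⟫) ∧
      ∀ x ∈ U, ∀ y ∈ U,
        dist ((h / ⟪(x : EuclideanSpace ℝ (Fin n)), v⟫) • (x : EuclideanSpace ℝ (Fin n)))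
          ((h / ⟪(y : EuclideanSpace ℝ (Fin n)), v⟫) • (y : EuclideanSpace ℝ (Fin n))) ≤
            c * dist x y ∧
        dist x y ≤ c *
          dist ((h / ⟪(x : EuclideanSpace ℝ (Fin n)), v⟫) • (x : EuclideanSpace ℝ (Fin n)))
            ((h / ⟪(y : EuclideanSpace ℝ (Fin n)), v⟫) • (y : EuclideanSpace ℝ (Fin n))) := by
  obtain ⟨r, hr, hrK⟩ := exists_pos_le_inner_of_normal h0
  have hpos : 0 < h := by
    rw [hh, hv]
    exact hr.trans_le (hrK _ _ fun y hy => inner_gaussMap_le hK x₀ hy)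
  refine ⟨hpos, ?_⟩
  have hcpos : 0 < c := by linarith
  obtain ⟨R, hR, hRK⟩ : ∃ R : ℝ, 0 < R ∧ ∀ y ∈ K, ‖y‖ ≤ R := hK.isBounded.exists_pos_norm_le
  -- If the projection differs from the identity by at most δ‖x - y‖ on differences, its constants
  -- are 1 + δ ≤ c and 1 - δ = 1 / c.
  set δ : ℝ := 1 - c⁻¹ with hδ
  have hδ0 : 0 < δ := by rw [hδ, sub_pos]; exact inv_lt_one_of_one_lt₀ hc1
  have hδc : 1 + δ ≤ c := by
    have : c * c⁻¹ = 1 := mul_inv_cancel₀ hcpos.ne'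
    have h2 : 0 < c⁻¹ := inv_pos.2 hcpos
    rw [hδ]; nlinarith [sq_nonneg (c - 1)]
  -- Chosen so that h η R = (δ / 2) h² / c², while the heights a, b of points of U satisfy h² / c² ≤
  -- a b.
  set η : ℝ := δ / 2 * h / (R * c ^ 2) with hη
  have hη0 : 0 < η := by positivity
  have hGc : Continuous fun x : regularBoundary K =>
      (gaussMap K x : EuclideanSpace ℝ (Fin n)) :=
    continuous_subtype_val.comp (continuous_gaussMap hK)
  let U : Set (regularBoundary K) := {x | 0 < ⟪(x : EuclideanSpace ℝ (Fin n)), v⟫} ∩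
    {x | ⟪(x : EuclideanSpace ℝ (Fin n)), v⟫ < c * h} ∩
    {x | h < c * ⟪(x : EuclideanSpace ℝ (Fin n)), v⟫} ∩
    {x | ⟪(x : EuclideanSpace ℝ (Fin n)), (gaussMap K x : EuclideanSpace ℝ (Fin n))⟫ < c * h} ∩
    {x | h < c * ⟪(x : EuclideanSpace ℝ (Fin n)), (gaussMap K x : EuclideanSpace ℝ (Fin n))⟫} ∩
    {x | |h - ⟪(x : EuclideanSpace ℝ (Fin n)), v⟫| <
      δ / 2 * ⟪(x : EuclideanSpace ℝ (Fin n)), v⟫} ∩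
    {x | ‖(gaussMap K x : EuclideanSpace ℝ (Fin n)) - v‖ < η}
  have hUo : IsOpen U := by
    refine IsOpen.inter (IsOpen.inter (IsOpen.inter (IsOpen.inter (IsOpen.inter
      (IsOpen.inter ?_ ?_) ?_) ?_) ?_) ?_) ?_ <;> exact isOpen_lt (by fun_prop) (by fun_prop)
  have hch : h < c * h := by nlinarith
  refine ⟨U, hUo, ?_, ?_, ?_⟩
  · refine ⟨⟨⟨⟨⟨⟨?_, ?_⟩, ?_⟩, ?_⟩, ?_⟩, ?_⟩, ?_⟩ <;>
      simp only [mem_ofPred_eq, ← hv, ← hh, sub_self, abs_zero, norm_zero] <;> first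
      | assumption
      | positivity
  · rintro x ⟨⟨⟨⟨⟨⟨h1, h2⟩, h3⟩, h4⟩, h5⟩, h6⟩, h7⟩
    exact ⟨h1, le_of_lt h2, le_of_lt h3, le_of_lt h4, le_of_lt h5⟩
  rintro x ⟨⟨⟨⟨⟨⟨hx1, hx2⟩, hx3⟩, hx4⟩, hx5⟩, hx6⟩, hx7⟩ y
    ⟨⟨⟨⟨⟨⟨hy1, hy2⟩, hy3⟩, hy4⟩, hy5⟩, hy6⟩, hy7⟩
  simp only [mem_ofPred_eq] at *
  have hx8 := inner_gaussMap_le hK x (mem_of_mem_regularBoundary hK y)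
  have hy8 := inner_gaussMap_le hK y (mem_of_mem_regularBoundary hK x)
  have hyR := hRK y (mem_of_mem_regularBoundary hK y)
  rw [Subtype.dist_eq, dist_eq_norm, dist_eq_norm]
  generalize (gaussMap K x : EuclideanSpace ℝ (Fin n)) = νx at *
  generalize (gaussMap K y : EuclideanSpace ℝ (Fin n)) = νy at *
  generalize (x : EuclideanSpace ℝ (Fin n)) = x at *
  generalize (y : EuclideanSpace ℝ (Fin n)) = y at *
  clear hv hh U hUo hGc
  -- The normals give ⟪x - y, νy⟫ ≤ 0 ≤ ⟪x - y, νx⟫, and both are within η of v. Thus the height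
  -- over the tangent hyperplane varies with a small Lipschitz constant.
  have hd : |⟪x, v⟫ - ⟪y, v⟫| ≤ η * ‖x - y‖ := by
    rw [abs_le]
    have e1 : ⟪x - y, νy - v⟫ ≥ -(η * ‖x - y‖) := by
      have := abs_real_inner_le_norm (x - y) (νy - v)
      have h2 : ‖x - y‖ * ‖νy - v‖ ≤ η * ‖x - y‖ := by
        rw [mul_comm]; exact mul_le_mul_of_nonneg_right hy7.le (norm_nonneg _)
      linarith [neg_abs_le ⟪x - y, νy - v⟫]
    have e2 : ⟪x - y, νx - v⟫ ≤ η * ‖x - y‖ := by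
      have := abs_real_inner_le_norm (x - y) (νx - v)
      have h2 : ‖x - y‖ * ‖νx - v‖ ≤ η * ‖x - y‖ := by
        rw [mul_comm]; exact mul_le_mul_of_nonneg_right hx7.le (norm_nonneg _)
      linarith [le_abs_self ⟪x - y, νx - v⟫]
    simp only [inner_sub_left, inner_sub_right] at e1 e2
    constructor <;> linarith
  set a := ⟪x, v⟫
  set b := ⟪y, v⟫
  -- The first term measures how far the scaling h / a is from 1, the second how much the scaling
  -- changes from x to y; each gets half of δ.
  have hdec : (h / a) • x - (h / b) • y - (x - y) =
      ((h - a) / a) • (x - y) + (h * (b - a) / (a * b)) • y := by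
    have e1 : (h - a) / a = h / a - 1 := by field_simp
    have e2 : h * (b - a) / (a * b) = h / a - h / b := by field_simp
    rw [e1, e2]
    module
  have hE : ‖(h / a) • x - (h / b) • y - (x - y)‖ ≤ δ * ‖x - y‖ := by
    rw [hdec]
    refine (norm_add_le _ _).trans ?_
    rw [norm_smul, norm_smul, Real.norm_eq_abs, Real.norm_eq_abs, abs_div, abs_div, abs_mul,
      abs_of_pos hx1, abs_of_pos hpos, abs_of_pos (mul_pos hx1 hy1)]
    have t1 : |h - a| / a ≤ δ / 2 := by rw [div_le_iff₀ hx1]; exact hx6.le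
    have hab : h ^ 2 ≤ c ^ 2 * (a * b) := by
      have := mul_le_mul hx3.le hy3.le hpos.le (by positivity)
      nlinarith
    have t2 : h * |b - a| / (a * b) * ‖y‖ ≤ δ / 2 * ‖x - y‖ := by
      rw [div_mul_eq_mul_div, div_le_iff₀ (mul_pos hx1 hy1)]
      rw [abs_sub_comm] at hd
      have s1 : h * |b - a| * ‖y‖ ≤ h * (η * ‖x - y‖) * R := by gcongr
      have s2 : h * (η * ‖x - y‖) * R = δ / 2 * ‖x - y‖ * (h ^ 2 / c ^ 2) := by
        rw [hη]; field_simp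
      have s3 : h ^ 2 / c ^ 2 ≤ a * b := by
        rw [div_le_iff₀ (by positivity)]; linarith
      rw [s2] at s1
      exact s1.trans (mul_le_mul_of_nonneg_left s3 (by positivity))
    have t3 := mul_le_mul_of_nonneg_right t1 (norm_nonneg (x - y))
    linarith
  have hxy := norm_nonneg (x - y)
  constructor
  · have := norm_le_norm_add_norm_sub' ((h / a) • x - (h / b) • y) (x - y)
    nlinarith
  · have h1 := norm_le_norm_add_norm_sub' (x - y) ((h / a) • x - (h / b) • y)
    rw [norm_sub_rev (x - y)] at h1
    have h2 : c⁻¹ * ‖x - y‖ ≤ ‖(h / a) • x - (h / b) • y‖ := by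
      have : c⁻¹ = 1 - δ := by rw [hδ]; ring
      rw [this]; linarith
    rwa [inv_mul_le_iff₀ hcpos] at h2

end

/-! ### Hausdorff measure and cone measure on the regular boundary -/

section

theorem euclideanHausdorffMeasure_image_le {X Y : Type*} [MetricSpace X] [MeasurableSpace X]
    [BorelSpace X] [MetricSpace Y] [MeasurableSpace Y] [BorelSpace Y] {f : X → Y} {A : Set X}
    {c : ℝ} (hc : 0 ≤ c) (d : ℕ) (hf : ∀ x ∈ A, ∀ y ∈ A, dist (f x) (f y) ≤ c * dist x y) :
    μHE[d] (f '' A) ≤ ENNReal.ofReal c ^ d * μHE[d] A := by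
  have hL : LipschitzOnWith c.toNNReal f A := LipschitzOnWith.of_dist_le_mul fun x hx y hy => by
    rw [Real.coe_toNNReal _ hc]; exact hf x hx y hy
  have := hL.hausdorffMeasure_image_le (d := d) (by positivity)
  rw [ENNReal.rpow_natCast] at this
  simp only [Measure.euclideanHausdorffMeasure_def, Measure.smul_apply, ENNReal.smul_def,
    smul_eq_mul]
  rw [mul_left_comm]
  exact mul_le_mul_right this _

theorem euclideanHausdorffMeasure_le_image {X Y : Type*} [MetricSpace X] [MeasurableSpace X]
    [BorelSpace X] [MetricSpace Y] [MeasurableSpace Y] [BorelSpace Y] {f : X → Y} {A : Set X}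
    {c : ℝ} (hc : 0 ≤ c) (d : ℕ) (hf : ∀ x ∈ A, ∀ y ∈ A, dist x y ≤ c * dist (f x) (f y)) :
    μHE[d] A ≤ ENNReal.ofReal c ^ d * μHE[d] (f '' A) := by
  have hL : AntilipschitzWith c.toNNReal (fun x : A => f x) :=
    AntilipschitzWith.of_le_mul_dist fun x y => by
      rw [Real.coe_toNNReal _ hc]; exact hf x x.2 y y.2
  have := hL.le_hausdorffMeasure_image (d := d) (by positivity) univ
  have h2 := (isometry_subtype_coe (s := A)).hausdorffMeasure_image (d := d)
    (Or.inl (by positivity)) univ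
  rw [image_univ, Subtype.range_coe] at h2
  rw [ENNReal.rpow_natCast, ← h2, image_univ, range_comp' f, Subtype.range_coe] at this
  simp only [Measure.euclideanHausdorffMeasure_def, Measure.smul_apply, ENNReal.smul_def,
    smul_eq_mul]
  rw [mul_left_comm]
  exact mul_le_mul_right this _

variable {n : ℕ} {K : Set (EuclideanSpace ℝ (Fin n))}

open Classical in
/-- The radial projection of `ℝⁿ` to the regular boundary of `K`, with the value `z₀` where the ray
does not meet it. -/
noncomputable def radialProj (K : Set (EuclideanSpace ℝ (Fin n))) (z₀ : regularBoundary K)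
    (x : EuclideanSpace ℝ (Fin n)) : regularBoundary K :=
  if h : (gauge K x)⁻¹ • x ∈ regularBoundary K then ⟨_, h⟩ else z₀

theorem measurable_radialProj (hc : Convex ℝ K) (h0 : K ∈ 𝓝 0)
    (hZ : MeasurableSet (regularBoundary K)) (z₀ : regularBoundary K) :
    Measurable (radialProj K z₀) := by
  classical
  rw [← (MeasurableEmbedding.subtype_coe hZ).measurable_comp_iff]
  have hm : Measurable fun x : EuclideanSpace ℝ (Fin n) => (gauge K x)⁻¹ • x := by
    have := (continuous_gauge hc h0).measurable
    fun_prop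
  have : Subtype.val ∘ radialProj K z₀ = fun x => if (gauge K x)⁻¹ • x ∈ regularBoundary K then
      (gauge K x)⁻¹ • x else (z₀ : EuclideanSpace ℝ (Fin n)) := by
    ext1 x
    simp only [Function.comp, radialProj]
    split_ifs <;> rfl
  rw [this]
  exact Measurable.ite (hm hZ) hm measurable_const

/-- The cone measure of a subset of the regular boundary is the volume of the cone over it. -/
theorem map_radialProj_apply (hn : 1 ≤ n) (hK : IsCompact K) (hc : Convex ℝ K) (h0 : K ∈ 𝓝 0)
    (hs : ∀ x ∈ frontier K, ∃ v : Metric.sphere (0 : EuclideanSpace ℝ (Fin n)) 1,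
      x ∈ supportHyperplane K v) (z₀ : regularBoundary K) {A : Set (regularBoundary K)}
    (hA : MeasurableSet A) :
    Measure.map (radialProj K z₀) (volume.restrict K) A =
      volume (Ioc (0 : ℝ) 1 • ((↑) '' A : Set (EuclideanSpace ℝ (Fin n)))) := by
  have : Nonempty (Fin n) := ⟨⟨0, hn⟩⟩
  have hm := measurable_radialProj hc h0 (measurableSet_regularBoundary hK hs) z₀
  rw [Measure.map_apply hm hA, Measure.restrict_apply (hm hA)]
  refine measure_congr ?_
  have h1 : ∀ᵐ x : EuclideanSpace ℝ (Fin n), x ≠ 0 := compl_mem_ae_iff.2 (measure_singleton 0)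
  -- Off this null set the default value z₀ plays no role, and x is its gauge times its projection.
  filter_upwards [h1, ae_inv_gauge_smul_mem_regularBoundary hK hc h0 hs] with x hx hreg
  have hreg := hreg hx
  have hg := gauge_pos_of_ne_zero hK h0 hx
  have hp : radialProj K z₀ x = ⟨_, hreg⟩ := dif_pos hreg
  refine propext ?_
  change radialProj K z₀ x ∈ A ∧ x ∈ K ↔ x ∈ Ioc (0 : ℝ) 1 • (Subtype.val '' A)
  rw [hp]
  constructor
  · rintro ⟨hxA, hxK⟩
    exact ⟨gauge K x, ⟨hg, gauge_le_one_of_mem hxK⟩, _, ⟨_, hxA, rfl⟩,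
      smul_inv_smul₀ hg.ne' x⟩
  · rintro ⟨s, hs, _, ⟨a, ha, rfl⟩, rfl⟩
    have hga : gauge K (a : EuclideanSpace ℝ (Fin n)) = 1 :=
      (gauge_eq_one_iff_mem_frontier hc h0).2 a.2.1
    have hgs : gauge K (s • (a : EuclideanSpace ℝ (Fin n))) = s := by
      rw [gauge_smul_of_pos K s hs.1, hga, mul_one]
    constructor
    · convert ha
      simp only [hgs]
      exact inv_smul_smul₀ hs.1.ne' _
    · exact (setOf_gauge_le_one hK hc h0).subset (hgs.le.trans hs.2)

/-- Stretching the base points radially by factors at most c keeps the cone inside its dilate by c.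
-/
theorem volume_cone_le {A B : Set (EuclideanSpace ℝ (Fin n))} {c : ℝ} (hc : 0 < c)
    (hAB : ∀ b ∈ B, ∃ a ∈ A, ∃ r : ℝ, 0 < r ∧ r ≤ c ∧ b = r • a) :
    volume (Ioc (0 : ℝ) 1 • B) ≤ ENNReal.ofReal c ^ n * volume (Ioc (0 : ℝ) 1 • A) := by
  have h : Ioc (0 : ℝ) 1 • B ⊆ c • (Ioc (0 : ℝ) 1 • A) := by
    rintro _ ⟨s, hs, b, hb, rfl⟩
    obtain ⟨a, ha, r, hr, hrc, rfl⟩ := hAB b hb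
    refine ⟨(s * r / c) • a, ⟨s * r / c, ⟨by have := hs.1; positivity, ?_⟩, a, ha, rfl⟩, ?_⟩
    · rw [div_le_one hc]
      nlinarith [hs.1, hs.2]
    · simp only [smul_smul]
      congr 1
      field_simp
  refine (measure_mono h).trans (le_of_eq ?_)
  rw [Measure.addHaar_smul, finrank_euclideanSpace, Fintype.card_fin,
    abs_of_pos (by positivity), ENNReal.ofReal_pow hc.le]

/-- Up to a factor close to one, the cone measure with the density `n / ⟪x, ν x⟫` coincides with
the Hausdorff measure near each regular point. -/
theorem exists_open_hausdorff_cone_measure_compare (hn : 1 ≤ n) (hK : IsCompact K)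
    (hc : Convex ℝ K) (h0 : K ∈ 𝓝 0)
    (hs : ∀ x ∈ frontier K, ∃ v : Metric.sphere (0 : EuclideanSpace ℝ (Fin n)) 1,
      x ∈ supportHyperplane K v) (z₀ x₀ : regularBoundary K) {c : ℝ} (hc1 : 1 < c) :
    ∃ U : Set (regularBoundary K), IsOpen U ∧ x₀ ∈ U ∧ ∀ A, MeasurableSet A → A ⊆ U →
      (Measure.map (radialProj K z₀) (volume.restrict K)).withDensity (fun z =>
        ENNReal.ofReal (n / ⟪(z : EuclideanSpace ℝ (Fin n)),
          (gaussMap K z : EuclideanSpace ℝ (Fin n))⟫)) A ≤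
            ENNReal.ofReal c ^ (2 * n) * μHE[n - 1] A ∧
      μHE[n - 1] A ≤ ENNReal.ofReal c ^ (2 * n) *
        (Measure.map (radialProj K z₀) (volume.restrict K)).withDensity (fun z =>
          ENNReal.ofReal (n / ⟪(z : EuclideanSpace ℝ (Fin n)),
            (gaussMap K z : EuclideanSpace ℝ (Fin n))⟫)) A := by
  have hZ := measurableSet_regularBoundary hK hs
  have hnpos : (0 : ℝ) < n := by exact_mod_cast hn
  obtain ⟨v, hv⟩ : ∃ v : EuclideanSpace ℝ (Fin n), v = gaussMap K x₀ := ⟨_, rfl⟩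
  obtain ⟨h, hh⟩ : ∃ h : ℝ, h = ⟪(x₀ : EuclideanSpace ℝ (Fin n)), v⟫ := ⟨_, rfl⟩
  obtain ⟨hpos, U, hUo, hxU, hU1, hU2⟩ :=
    exists_open_central_projection_near_isometry hK h0 x₀ hc1 hv hh
  have hcpos : 0 < c := by linarith
  refine ⟨U, hUo, hxU, fun A hA hAU => ?_⟩
  set κ := Measure.map (radialProj K z₀) (volume.restrict K) with hκ
  set A' : Set (EuclideanSpace ℝ (Fin n)) := (↑) '' A with hA'
  have hA'm : MeasurableSet A' := hZ.subtype_image hA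
  set Q : EuclideanSpace ℝ (Fin n) → EuclideanSpace ℝ (Fin n) := fun x => (h / ⟪x, v⟫) • x with hQ
  have hQm : Measurable Q := by fun_prop
  set B := Q '' A' with hB
  have hB2 : B = (fun z : regularBoundary K => Q z) '' A := by rw [hB, hA', image_image]
  -- Q is injective on A' by the lower distance bound, so the image is measurable by the
  -- Lusin–Souslin theorem.
  have hBm : MeasurableSet B := by
    refine hA'm.image_of_measurable_injOn hQm ?_
    rintro _ ⟨x, hx, rfl⟩ _ ⟨y, hy, rfl⟩ hxy
    have := (hU2 x (hAU hx) y (hAU hy)).2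
    have hxy' : (h / ⟪(x : EuclideanSpace ℝ (Fin n)), v⟫) • (x : EuclideanSpace ℝ (Fin n)) =
      (h / ⟪(y : EuclideanSpace ℝ (Fin n)), v⟫) • (y : EuclideanSpace ℝ (Fin n)) := hxy
    rw [hxy', dist_self, mul_zero] at this
    rw [dist_le_zero.1 this]
  have hBv : ∀ x ∈ B, ⟪x, v⟫ = h := by
    rintro _ ⟨_, ⟨x, hx, rfl⟩, rfl⟩
    have := (hU1 x (hAU hx)).1
    simp only [hQ, real_inner_smul_left]
    rw [div_mul_cancel₀ _ this.ne']
  have hvn : ‖v‖ = 1 := by rw [hv]; simp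
  have hcone := volume_cone_of_subset_hyperplane hn hvn hpos hBm hBv
  have hκA : κ A = volume (Ioc (0 : ℝ) 1 • A') := map_radialProj_apply hn hK hc h0 hs z₀ hA
  set C := ENNReal.ofReal c with hC
  have hH1 : μHE[n - 1] B ≤ C ^ (n - 1) * μHE[n - 1] A := by
    rw [hB2]
    exact euclideanHausdorffMeasure_image_le hcpos.le _ fun x hx y hy =>
      (hU2 x (hAU hx) y (hAU hy)).1
  have hH2 : μHE[n - 1] A ≤ C ^ (n - 1) * μHE[n - 1] B := by
    rw [hB2]
    exact euclideanHausdorffMeasure_le_image hcpos.le _ fun x hx y hy =>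
      (hU2 x (hAU hx) y (hAU hy)).2
  have hV1 : volume (Ioc (0 : ℝ) 1 • B) ≤ C ^ n * κ A := by
    rw [hκA]
    refine volume_cone_le hcpos ?_
    rintro _ ⟨_, ⟨x, hx, rfl⟩, rfl⟩
    obtain ⟨h1, h2, h3, -⟩ := hU1 x (hAU hx)
    exact ⟨x, ⟨x, hx, rfl⟩, h / ⟪(x : EuclideanSpace ℝ (Fin n)), v⟫, by positivity,
      by rwa [div_le_iff₀ h1], rfl⟩
  have hV2 : κ A ≤ C ^ n * volume (Ioc (0 : ℝ) 1 • B) := by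
    rw [hκA]
    refine volume_cone_le hcpos ?_
    rintro _ ⟨x, hx, rfl⟩
    obtain ⟨h1, h2, h3, -⟩ := hU1 x (hAU hx)
    refine ⟨_, ⟨x, ⟨x, hx, rfl⟩, rfl⟩, ⟪(x : EuclideanSpace ℝ (Fin n)), v⟫ / h, by positivity,
      by rwa [div_le_iff₀ hpos], ?_⟩
    rw [smul_smul, div_mul_div_cancel₀ hpos.ne', div_self h1.ne', one_smul]
  rw [withDensity_apply _ hA]
  have hD1 : ∫⁻ z in A, ENNReal.ofReal (n / ⟪(z : EuclideanSpace ℝ (Fin n)),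
      (gaussMap K z : EuclideanSpace ℝ (Fin n))⟫) ∂κ ≤ C * ENNReal.ofReal (n / h) * κ A := by
    rw [← setLIntegral_const]
    refine setLIntegral_mono measurable_const fun z hz => ?_
    obtain ⟨-, -, -, h4, h5⟩ := hU1 z (hAU hz)
    have hb : 0 < ⟪(z : EuclideanSpace ℝ (Fin n)),
      (gaussMap K z : EuclideanSpace ℝ (Fin n))⟫ := by by_contra hcon; nlinarith
    rw [hC, ← ENNReal.ofReal_mul hcpos.le]
    refine ENNReal.ofReal_le_ofReal ?_
    rw [div_le_iff₀ hb, ← mul_div_assoc, div_mul_eq_mul_div, le_div_iff₀ hpos]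
    nlinarith
  have hD2 : ENNReal.ofReal (n / h) * κ A ≤ C * ∫⁻ z in A,
      ENNReal.ofReal (n / ⟪(z : EuclideanSpace ℝ (Fin n)),
      (gaussMap K z : EuclideanSpace ℝ (Fin n))⟫) ∂κ := by
    rw [← setLIntegral_const, ← lintegral_const_mul' _ _ ENNReal.ofReal_ne_top]
    refine setLIntegral_mono' hA fun z hz => ?_
    obtain ⟨-, -, -, h4, h5⟩ := hU1 z (hAU hz)
    have hb : 0 < ⟪(z : EuclideanSpace ℝ (Fin n)),
      (gaussMap K z : EuclideanSpace ℝ (Fin n))⟫ := by by_contra hcon; nlinarith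
    rw [← ENNReal.ofReal_mul hcpos.le]
    refine ENNReal.ofReal_le_ofReal ?_
    rw [div_le_iff₀ hpos, ← mul_div_assoc, div_mul_eq_mul_div, le_div_iff₀ hb]
    nlinarith
  have hnh : ENNReal.ofReal (n / h) * ENNReal.ofReal (h / n) = 1 := by
    rw [← ENNReal.ofReal_mul (by positivity), div_mul_div_cancel₀ hpos.ne',
      div_self hnpos.ne', ENNReal.ofReal_one]
  -- The three losses: C for freezing the density at n / h, Cⁿ for replacing the cone over A' by
  -- that over B, Cⁿ⁻¹ for the Hausdorff measure.
  have hpow : C ^ (2 * n) = C * C ^ n * C ^ (n - 1) := by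
    rw [← pow_succ', ← pow_add]; congr 1; omega
  constructor
  · calc _ ≤ C * ENNReal.ofReal (n / h) * κ A := hD1
      _ ≤ C * ENNReal.ofReal (n / h) * (C ^ n * (ENNReal.ofReal (h / n) *
          (C ^ (n - 1) * μHE[n - 1] A))) := by
        gcongr
        refine hV2.trans ?_
        rw [hcone]
        gcongr
      _ = (ENNReal.ofReal (n / h) * ENNReal.ofReal (h / n)) *
          (C * C ^ n * C ^ (n - 1)) * μHE[n - 1] A := by ring
      _ = _ := by rw [hnh, one_mul, hpow]
  · calc μHE[n - 1] A ≤ C ^ (n - 1) * μHE[n - 1] B := hH2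
      _ = C ^ (n - 1) * (ENNReal.ofReal (n / h) * volume (Ioc (0 : ℝ) 1 • B)) := by
        rw [hcone, ← mul_assoc (ENNReal.ofReal (n / h)), hnh, one_mul]
      _ ≤ C ^ (n - 1) * (ENNReal.ofReal (n / h) * (C ^ n * κ A)) := by gcongr
      _ = C ^ (n - 1) * C ^ n * (ENNReal.ofReal (n / h) * κ A) := by ring
      _ ≤ C ^ (n - 1) * C ^ n * (C * _) := by gcongr
      _ = _ := by rw [hpow]; ring

theorem measure_le_of_forall_one_lt_le {X : Type*} [MeasurableSpace X] {μ ν : Measure X} (m : ℕ)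
    (h : ∀ c : ℝ, 1 < c → μ ≤ ENNReal.ofReal c ^ m • ν) : μ ≤ ν := by
  refine Measure.le_iff'.2 fun A => ?_
  have ht : Tendsto (fun c : ℝ => ENNReal.ofReal c ^ m * ν A) (𝓝[>] 1) (𝓝 (ν A)) := by
    have h1 : Tendsto (fun c : ℝ => ENNReal.ofReal c ^ m) (𝓝[>] 1) (𝓝 1) := by
      have : Tendsto (fun c : ℝ => ENNReal.ofReal c ^ m) (𝓝 1) (𝓝 (ENNReal.ofReal 1 ^ m)) :=
        ((ENNReal.continuous_pow m).comp ENNReal.continuous_ofReal).tendsto 1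
      rw [ENNReal.ofReal_one, one_pow] at this
      exact this.mono_left nhdsWithin_le_nhds
    simpa using ENNReal.Tendsto.mul_const h1 (Or.inl one_ne_zero) (b := ν A)
  refine ge_of_tendsto ht ?_
  filter_upwards [self_mem_nhdsWithin] with c hc
  exact h c hc A

/-- The Hausdorff measure on the regular boundary in terms of the cone measure. -/
theorem euclideanHausdorffMeasure_regularBoundary (hn : 1 ≤ n) (hK : IsCompact K)
    (hc : Convex ℝ K) (h0 : K ∈ 𝓝 0)
    (hs : ∀ x ∈ frontier K, ∃ v : Metric.sphere (0 : EuclideanSpace ℝ (Fin n)) 1,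
      x ∈ supportHyperplane K v) (z₀ : regularBoundary K) :
    (μHE[n - 1] : Measure (regularBoundary K)) =
      (Measure.map (radialProj K z₀) (volume.restrict K)).withDensity (fun z =>
        ENNReal.ofReal (n / ⟪(z : EuclideanSpace ℝ (Fin n)),
          (gaussMap K z : EuclideanSpace ℝ (Fin n))⟫)) := by
  refine le_antisymm (measure_le_of_forall_one_lt_le (2 * n) fun c hc1 => ?_)
    (measure_le_of_forall_one_lt_le (2 * n) fun c hc1 => ?_)
  · refine measure_le_of_locally_le fun x => ?_
    obtain ⟨U, hUo, hxU, hU⟩ :=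
      exists_open_hausdorff_cone_measure_compare hn hK hc h0 hs z₀ x hc1
    exact ⟨U, hUo, hxU, fun A hA hAU => (hU A hA hAU).2⟩
  · refine measure_le_of_locally_le fun x => ?_
    obtain ⟨U, hUo, hxU, hU⟩ :=
      exists_open_hausdorff_cone_measure_compare hn hK hc h0 hs z₀ x hc1
    exact ⟨U, hUo, hxU, fun A hA hAU => (hU A hA hAU).1⟩

end

/-! ### Wulff shapes: active constraints and ratios of gauges -/

section

variable {n : ℕ} {Ω : Set (Metric.sphere (0 : EuclideanSpace ℝ (Fin n)) 1)}
  {h : Metric.sphere (0 : EuclideanSpace ℝ (Fin n)) 1 → ℝ}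

theorem nonempty_of_not_subset_hemisphere (hn : 1 ≤ n)
    (hΩ_hemi : ∀ u : Metric.sphere (0 : EuclideanSpace ℝ (Fin n)) 1, ¬ Ω ⊆ closedHemisphere u) :
    Ω.Nonempty := by
  have : Nonempty (Fin n) := ⟨⟨0, hn⟩⟩
  obtain ⟨u⟩ : Nonempty (Metric.sphere (0 : EuclideanSpace ℝ (Fin n)) 1) :=
    (NormedSpace.sphere_nonempty.2 zero_le_one).to_subtype
  by_contra hne
  rw [not_nonempty_iff_eq_empty] at hne
  exact hΩ_hemi u (by simp [hne])

theorem isClosed_wulffShape (Ω : Set (Metric.sphere (0 : EuclideanSpace ℝ (Fin n)) 1))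
    (h : Metric.sphere (0 : EuclideanSpace ℝ (Fin n)) 1 → ℝ) : IsClosed (wulffShape Ω h) := by
  simp only [wulffShape, Set.ofPred_forall]
  exact isClosed_biInter fun y _ => isClosed_le (by fun_prop) (by fun_prop)

theorem convex_wulffShape (Ω : Set (Metric.sphere (0 : EuclideanSpace ℝ (Fin n)) 1))
    (h : Metric.sphere (0 : EuclideanSpace ℝ (Fin n)) 1 → ℝ) : Convex ℝ (wulffShape Ω h) := by
  intro x hx y hy a b ha hb hab v hv
  have h1 := hx v hv
  have h2 := hy v hv
  rw [inner_add_left, real_inner_smul_left, real_inner_smul_left]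
  have hb' : b = 1 - a := by linarith
  subst hb'
  nlinarith

/-- Applied to -u, the hemisphere condition gives some v in Ω with u · v > 0; compactness of the
sphere makes this bound uniform. It is what makes Wulff shapes bounded. -/
theorem exists_pos_forall_exists_lt_inner
    (hΩ_hemi : ∀ u : Metric.sphere (0 : EuclideanSpace ℝ (Fin n)) 1, ¬ Ω ⊆ closedHemisphere u) :
    ∃ ε : ℝ, 0 < ε ∧ ∀ u : Metric.sphere (0 : EuclideanSpace ℝ (Fin n)) 1, ∃ v ∈ Ω,
      ε < ⟪(u : EuclideanSpace ℝ (Fin n)), (v : EuclideanSpace ℝ (Fin n))⟫ := by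
  let W : ℕ → Set (Metric.sphere (0 : EuclideanSpace ℝ (Fin n)) 1) := fun k =>
    ⋃ v ∈ Ω, {u | 1 / ((k : ℝ) + 1) <
      ⟪(u : EuclideanSpace ℝ (Fin n)), (v : EuclideanSpace ℝ (Fin n))⟫}
  have hWo : ∀ k, IsOpen (W k) := fun k => isOpen_biUnion fun v _ =>
    isOpen_lt continuous_const (by fun_prop)
  have hcov : univ ⊆ ⋃ k, W k := by
    intro u _
    obtain ⟨v, hv, hvu⟩ := not_subset.1 (hΩ_hemi (-u))
    have hpos : 0 < ⟪(u : EuclideanSpace ℝ (Fin n)), (v : EuclideanSpace ℝ (Fin n))⟫ := by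
      simpa [closedHemisphere] using hvu
    obtain ⟨k, hk⟩ := exists_nat_one_div_lt hpos
    exact mem_iUnion.2 ⟨k, mem_biUnion hv hk⟩
  have hmono : Monotone W := by
    intro k l hkl u hu
    simp only [W, mem_iUnion] at hu ⊢
    obtain ⟨v, hv, hvu⟩ := hu
    exact ⟨v, hv, (Nat.one_div_le_one_div hkl).trans_lt (mem_ofPred_eq ▸ hvu)⟩
  obtain ⟨k, hk⟩ := isCompact_univ.elim_directed_cover W hWo hcov hmono.directed_le
  refine ⟨1 / ((k : ℝ) + 1), by positivity, fun u => ?_⟩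
  have hu := hk (mem_univ u)
  simp only [W, mem_iUnion] at hu
  obtain ⟨v, hv, hvu⟩ := hu
  exact ⟨v, hv, hvu⟩

theorem isCompact_wulffShape (hΩ : IsClosed Ω)
    (hΩ_hemi : ∀ u : Metric.sphere (0 : EuclideanSpace ℝ (Fin n)) 1, ¬ Ω ⊆ closedHemisphere u)
    (h_cont : ContinuousOn h Ω) : IsCompact (wulffShape Ω h) := by
  refine Metric.isCompact_of_isClosed_isBounded (isClosed_wulffShape Ω h) ?_
  obtain ⟨ε, hε, hεΩ⟩ := exists_pos_forall_exists_lt_inner hΩ_hemi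
  obtain ⟨M, hM⟩ := hΩ.isCompact.exists_bound_of_continuousOn h_cont
  refine isBounded_iff_forall_norm_le.2 ⟨|M| / ε, fun x hx => ?_⟩
  rcases eq_or_ne x 0 with rfl | hx0
  · rw [norm_zero]; positivity
  have hxn : 0 < ‖x‖ := norm_pos_iff.2 hx0
  obtain ⟨v, hv, hvx⟩ := hεΩ ⟨‖x‖⁻¹ • x, by simp [norm_smul, hxn.ne']⟩
  simp only [real_inner_smul_left] at hvx
  rw [lt_inv_mul_iff₀ hxn] at hvx
  rw [le_div_iff₀ hε]
  have h1 := hx v hv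
  have h2 := hM v hv
  rw [Real.norm_eq_abs] at h2
  linarith [le_abs_self (h v), le_abs_self M]

theorem wulffShape_mem_nhds_zero (hΩ : IsClosed Ω) (hne : Ω.Nonempty) (h_cont : ContinuousOn h Ω)
    (h_pos : ∀ v ∈ Ω, 0 < h v) : wulffShape Ω h ∈ 𝓝 0 := by
  obtain ⟨w, hw, hmin⟩ := hΩ.isCompact.exists_isMinOn hne h_cont
  refine Filter.mem_of_superset (Metric.closedBall_mem_nhds 0 (h_pos w hw)) fun x hx v hv => ?_
  have h1 : ‖x‖ ≤ h w := by simpa using hx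
  have h2 := real_inner_le_norm x (v : EuclideanSpace ℝ (Fin n))
  have hvn : ‖(v : EuclideanSpace ℝ (Fin n))‖ = 1 := by simp
  rw [hvn, mul_one] at h2
  exact h2.trans (h1.trans (hmin hv))

/-- If every constraint were strict at x, then h - ⟪x, ·⟫ would be continuous and positive on Ω. Its
Wulff shape, the translate of [h] by -x, would be a neighbourhood of 0, and x would be interior. -/
theorem exists_inner_eq_of_mem_frontier (hΩ : IsClosed Ω) (hne : Ω.Nonempty)
    (h_cont : ContinuousOn h Ω) {x : EuclideanSpace ℝ (Fin n)}
    (hx : x ∈ frontier (wulffShape Ω h)) :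
    ∃ v ∈ Ω, ⟪x, (v : EuclideanSpace ℝ (Fin n))⟫ = h v := by
  by_contra! hcon
  have hxW := (isClosed_wulffShape Ω h).frontier_subset hx
  have hc2 : ContinuousOn (fun v : Metric.sphere (0 : EuclideanSpace ℝ (Fin n)) 1 =>
      h v - ⟪x, (v : EuclideanSpace ℝ (Fin n))⟫) Ω :=
    h_cont.sub (Continuous.continuousOn (by fun_prop))
  have hnhds := wulffShape_mem_nhds_zero hΩ hne hc2 fun v hv =>
    sub_pos.2 (lt_of_le_of_ne (hxW v hv) (hcon v hv))
  refine hx.2 (mem_interior_iff_mem_nhds.2 ?_)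
  have ht : Tendsto (fun y : EuclideanSpace ℝ (Fin n) => y - x) (𝓝 x) (𝓝 0) := by
    have : Continuous fun y : EuclideanSpace ℝ (Fin n) => y - x := by fun_prop
    simpa using this.tendsto x
  filter_upwards [ht hnhds] with y hy v hv
  have := hy v hv
  rw [inner_sub_left] at this
  linarith

theorem mem_supportHyperplane_of_inner_eq (hK : IsCompact (wulffShape Ω h))
    {x : EuclideanSpace ℝ (Fin n)} (hx : x ∈ wulffShape Ω h)
    {v : Metric.sphere (0 : EuclideanSpace ℝ (Fin n)) 1} (hv : v ∈ Ω)
    (hxv : ⟪x, (v : EuclideanSpace ℝ (Fin n))⟫ = h v) :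
    x ∈ supportHyperplane (wulffShape Ω h) v :=
  (mem_supportHyperplane_iff hK hx _).2 fun _ hy => (hy v hv).trans hxv.ge

theorem exists_mem_supportHyperplane_wulffShape (hΩ : IsClosed Ω) (hne : Ω.Nonempty)
    (hΩ_hemi : ∀ u : Metric.sphere (0 : EuclideanSpace ℝ (Fin n)) 1, ¬ Ω ⊆ closedHemisphere u)
    (h_cont : ContinuousOn h Ω) (x : EuclideanSpace ℝ (Fin n))
    (hx : x ∈ frontier (wulffShape Ω h)) :
    ∃ v : Metric.sphere (0 : EuclideanSpace ℝ (Fin n)) 1,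
      x ∈ supportHyperplane (wulffShape Ω h) v := by
  obtain ⟨v, hv, hxv⟩ := exists_inner_eq_of_mem_frontier hΩ hne h_cont hx
  exact ⟨v, mem_supportHyperplane_of_inner_eq (isCompact_wulffShape hΩ hΩ_hemi h_cont)
    ((isClosed_wulffShape Ω h).frontier_subset hx) hv hxv⟩

/-- A constraint active at z is an outer normal there, so by uniqueness it is the Gauss image. Hence
the surface area measure lives on Ω, and h is the support number at regular points. -/
theorem gaussMap_wulffShape (hΩ : IsClosed Ω) (hne : Ω.Nonempty)
    (hΩ_hemi : ∀ u : Metric.sphere (0 : EuclideanSpace ℝ (Fin n)) 1, ¬ Ω ⊆ closedHemisphere u)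
    (h_cont : ContinuousOn h Ω) (z : regularBoundary (wulffShape Ω h)) :
    gaussMap _ z ∈ Ω ∧ ⟪(z : EuclideanSpace ℝ (Fin n)),
      (gaussMap _ z : EuclideanSpace ℝ (Fin n))⟫ = h (gaussMap _ z) := by
  obtain ⟨v, hv, hzv⟩ := exists_inner_eq_of_mem_frontier hΩ hne h_cont z.2.1
  have := eq_gaussMap _ z v (mem_supportHyperplane_of_inner_eq
    (isCompact_wulffShape hΩ hΩ_hemi h_cont)
    ((isClosed_wulffShape Ω h).frontier_subset z.2.1) hv hzv)
  exact this ▸ ⟨hv, hzv⟩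

theorem inner_le_gauge_mul (hΩ : IsClosed Ω) (hne : Ω.Nonempty)
    (hΩ_hemi : ∀ u : Metric.sphere (0 : EuclideanSpace ℝ (Fin n)) 1, ¬ Ω ⊆ closedHemisphere u)
    (h_cont : ContinuousOn h Ω) (h_pos : ∀ v ∈ Ω, 0 < h v) (x : EuclideanSpace ℝ (Fin n))
    {v : Metric.sphere (0 : EuclideanSpace ℝ (Fin n)) 1} (hv : v ∈ Ω) :
    ⟪x, (v : EuclideanSpace ℝ (Fin n))⟫ ≤ gauge (wulffShape Ω h) x * h v :=
  inner_le_mul_gauge (isCompact_wulffShape hΩ hΩ_hemi h_cont) (convex_wulffShape Ω h)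
    (wulffShape_mem_nhds_zero hΩ hne h_cont h_pos) (fun _ hy => hy v hv) x

theorem exists_inner_eq_gauge_mul (hΩ : IsClosed Ω) (hne : Ω.Nonempty)
    (hΩ_hemi : ∀ u : Metric.sphere (0 : EuclideanSpace ℝ (Fin n)) 1, ¬ Ω ⊆ closedHemisphere u)
    (h_cont : ContinuousOn h Ω) (h_pos : ∀ v ∈ Ω, 0 < h v) {x : EuclideanSpace ℝ (Fin n)}
    (hx : x ≠ 0) :
    ∃ v ∈ Ω, ⟪x, (v : EuclideanSpace ℝ (Fin n))⟫ = gauge (wulffShape Ω h) x * h v := by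
  have hK := isCompact_wulffShape hΩ hΩ_hemi h_cont
  have h0 := wulffShape_mem_nhds_zero hΩ hne h_cont h_pos
  have hg := gauge_pos_of_ne_zero hK h0 hx
  obtain ⟨v, hv, hxv⟩ := exists_inner_eq_of_mem_frontier hΩ hne h_cont
    (inv_gauge_smul_mem_frontier hK (convex_wulffShape Ω h) h0 hx)
  rw [real_inner_smul_left, inv_mul_eq_iff_eq_mul₀ hg.ne'] at hxv
  exact ⟨v, hv, hxv⟩

/-- A bound for the ratio of the gauges of two Wulff shapes. -/
theorem gauge_div_gauge_le (hΩ : IsClosed Ω) (hne : Ω.Nonempty)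
    (hΩ_hemi : ∀ u : Metric.sphere (0 : EuclideanSpace ℝ (Fin n)) 1, ¬ Ω ⊆ closedHemisphere u)
    (h_pos : ∀ v ∈ Ω, 0 < h v)
    {h' : Metric.sphere (0 : EuclideanSpace ℝ (Fin n)) 1 → ℝ}
    (h_cont' : ContinuousOn h' Ω) (h_pos' : ∀ v ∈ Ω, 0 < h' v)
    {x : EuclideanSpace ℝ (Fin n)} (hx : x ≠ 0)
    {v : Metric.sphere (0 : EuclideanSpace ℝ (Fin n)) 1} (hv : v ∈ Ω)
    (hxv : ⟪x, (v : EuclideanSpace ℝ (Fin n))⟫ = gauge (wulffShape Ω h) x * h v) :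
    gauge (wulffShape Ω h) x / gauge (wulffShape Ω h') x ≤ h' v / h v := by
  have hg := gauge_pos_of_ne_zero (isCompact_wulffShape hΩ hΩ_hemi h_cont')
    (wulffShape_mem_nhds_zero hΩ hne h_cont' h_pos') hx
  rw [div_le_div_iff₀ hg (h_pos v hv), ← hxv, mul_comm (h' v)]
  exact inner_le_gauge_mul hΩ hne hΩ_hemi h_cont' h_pos' x hv

/-- A direction active for h' need only satisfy the constraint inequality for h; this is the lower
half of the squeeze. -/
theorem le_gauge_div_gauge (hΩ : IsClosed Ω) (hne : Ω.Nonempty)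
    (hΩ_hemi : ∀ u : Metric.sphere (0 : EuclideanSpace ℝ (Fin n)) 1, ¬ Ω ⊆ closedHemisphere u)
    (h_cont : ContinuousOn h Ω) (h_pos : ∀ v ∈ Ω, 0 < h v)
    {h' : Metric.sphere (0 : EuclideanSpace ℝ (Fin n)) 1 → ℝ}
    (h_cont' : ContinuousOn h' Ω) (h_pos' : ∀ v ∈ Ω, 0 < h' v)
    {x : EuclideanSpace ℝ (Fin n)} (hx : x ≠ 0)
    {w : Metric.sphere (0 : EuclideanSpace ℝ (Fin n)) 1} (hw : w ∈ Ω)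
    (hxw : ⟪x, (w : EuclideanSpace ℝ (Fin n))⟫ = gauge (wulffShape Ω h') x * h' w) :
    h' w / h w ≤ gauge (wulffShape Ω h) x / gauge (wulffShape Ω h') x := by
  have hg := gauge_pos_of_ne_zero (isCompact_wulffShape hΩ hΩ_hemi h_cont')
    (wulffShape_mem_nhds_zero hΩ hne h_cont' h_pos') hx
  rw [div_le_div_iff₀ (h_pos w hw) hg, mul_comm (h' w), ← hxw]
  exact inner_le_gauge_mul hΩ hne hΩ_hemi h_cont h_pos x hw

theorem volume_wulffShape_toReal (hn : 1 ≤ n) (hΩ : IsClosed Ω)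
    (hΩ_hemi : ∀ u : Metric.sphere (0 : EuclideanSpace ℝ (Fin n)) 1, ¬ Ω ⊆ closedHemisphere u)
    (h_cont : ContinuousOn h Ω) (h_pos : ∀ v ∈ Ω, 0 < h v)
    {h' : Metric.sphere (0 : EuclideanSpace ℝ (Fin n)) 1 → ℝ}
    (h_cont' : ContinuousOn h' Ω) (h_pos' : ∀ v ∈ Ω, 0 < h' v) :
    (volume (wulffShape Ω h')).toReal = ∫ x in wulffShape Ω h,
      (gauge (wulffShape Ω h) x / gauge (wulffShape Ω h') x) ^ n := by
  have hne := nonempty_of_not_subset_hemisphere hn hΩ_hemi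
  have hK := isCompact_wulffShape hΩ hΩ_hemi h_cont
  have h0 := wulffShape_mem_nhds_zero hΩ hne h_cont h_pos
  have hK' := isCompact_wulffShape hΩ hΩ_hemi h_cont'
  have h0' := wulffShape_mem_nhds_zero hΩ hne h_cont' h_pos'
  have hm := (continuous_gauge (convex_wulffShape Ω h) h0).measurable
  have hm' := (continuous_gauge (convex_wulffShape Ω h') h0').measurable
  have := volume_sublevel_eq_lintegral hn hm (gauge_smul_of_pos _)
    (fun x hx => gauge_pos_of_ne_zero hK h0 hx) hm' (gauge_smul_of_pos _)
    (fun x hx => gauge_pos_of_ne_zero hK' h0' hx)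
  rw [setOf_gauge_le_one hK (convex_wulffShape Ω h) h0,
    setOf_gauge_le_one hK' (convex_wulffShape Ω h') h0'] at this
  rw [this, integral_eq_lintegral_of_nonneg_ae]
  · exact Filter.Eventually.of_forall fun x =>
      pow_nonneg (div_nonneg (gauge_nonneg _) (gauge_nonneg _)) _
  · exact ((hm.div hm').pow_const n).aestronglyMeasurable

theorem abs_pow_sub_one_le {q : ℝ} (n : ℕ) (hq0 : 0 ≤ q) (hq : q ≤ 2) :
    |q ^ n - 1| ≤ |q - 1| * (n * 2 ^ n) := by
  rw [← mul_geom_sum, abs_mul]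
  refine mul_le_mul_of_nonneg_left ?_ (abs_nonneg _)
  rw [abs_of_nonneg (Finset.sum_nonneg fun i _ => by positivity)]
  calc ∑ i ∈ Finset.range n, q ^ i ≤ ∑ i ∈ Finset.range n, (2 : ℝ) ^ n := by
        refine Finset.sum_le_sum fun i hi => ?_
        exact (pow_le_pow_left₀ hq0 hq i).trans
          (pow_le_pow_right₀ one_le_two (Finset.mem_range.1 hi).le)
    _ = n * 2 ^ n := by simp

theorem tendsto_pow_sub_one_div {q : ℝ → ℝ} {l : ℝ} (n : ℕ) (hq : Tendsto q (𝓝[≠] 0) (𝓝 1))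
    (hd : Tendsto (fun t => (q t - 1) / t) (𝓝[≠] 0) (𝓝 l)) :
    Tendsto (fun t => (q t ^ n - 1) / t) (𝓝[≠] 0) (𝓝 (n * l)) := by
  have h1 : Tendsto (fun t => ∑ i ∈ Finset.range n, q t ^ i) (𝓝[≠] 0) (𝓝 n) := by
    have := tendsto_finsetSum (Finset.range n) fun i _ => hq.pow i
    simpa using this
  have := h1.mul hd
  refine this.congr fun t => ?_
  rw [← mul_geom_sum]
  ring

end

/-! ### First variation of the volume -/

section

variable {n : ℕ} {Ω : Set (Metric.sphere (0 : EuclideanSpace ℝ (Fin n)) 1)}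

/-- The derivative of the ratio of the gauges along a ray through a regular point. -/
theorem tendsto_gauge_ratio_sub_one_div (hΩ : IsClosed Ω) (hne : Ω.Nonempty)
    (hΩ_hemi : ∀ u : Metric.sphere (0 : EuclideanSpace ℝ (Fin n)) 1, ¬ Ω ⊆ closedHemisphere u)
    {h₀ F : Metric.sphere (0 : EuclideanSpace ℝ (Fin n)) 1 → ℝ}
    (h₀_cont : ContinuousOn h₀ Ω) (h₀_pos : ∀ v ∈ Ω, 0 < h₀ v) (F_cont : ContinuousOn F Ω)
    {h : ℝ → Metric.sphere (0 : EuclideanSpace ℝ (Fin n)) 1 → ℝ}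
    (h_cont : ∀ᶠ t in 𝓝[≠] (0 : ℝ), ContinuousOn (h t) Ω)
    (h_pos : ∀ᶠ t in 𝓝[≠] (0 : ℝ), ∀ v ∈ Ω, 0 < h t v)
    (hF : TendstoUniformlyOn (fun t v => (h t v / h₀ v - 1) / t) F (𝓝[≠] (0 : ℝ)) Ω)
    {x : EuclideanSpace ℝ (Fin n)} (hx : x ≠ 0)
    (hreg : (gauge (wulffShape Ω h₀) x)⁻¹ • x ∈ regularBoundary (wulffShape Ω h₀)) :
    Tendsto (fun t => gauge (wulffShape Ω h₀) x / gauge (wulffShape Ω (h t)) x) (𝓝[≠] 0) (𝓝 1) ∧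
    Tendsto (fun t => (gauge (wulffShape Ω h₀) x / gauge (wulffShape Ω (h t)) x - 1) / t)
      (𝓝[≠] 0) (𝓝 (F (gaussMap _ ⟨_, hreg⟩))) := by
  have hK := isCompact_wulffShape hΩ hΩ_hemi h₀_cont
  have h0 := wulffShape_mem_nhds_zero hΩ hne h₀_cont h₀_pos
  have hg := gauge_pos_of_ne_zero hK h0 hx
  have hΩc : CompactSpace Ω := isCompact_iff_compactSpace.1 hΩ.isCompact
  obtain ⟨hv₀Ω, hv₀⟩ := gaussMap_wulffShape hΩ hne hΩ_hemi h₀_cont ⟨_, hreg⟩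
  have huniq := eq_gaussMap _ ⟨_, hreg⟩
  simp only at hv₀
  set v₀ := gaussMap _ ⟨_, hreg⟩
  rw [real_inner_smul_left, inv_mul_eq_iff_eq_mul₀ hg.ne'] at hv₀
  set q : ℝ → ℝ := fun t => gauge (wulffShape Ω h₀) x / gauge (wulffShape Ω (h t)) x with hq
  -- A direction w t active for h t on the ray of x; the Gauss image v₀ is a dummy value where h t
  -- is not admissible.
  have hex : ∀ t, ∃ v : Ω, ContinuousOn (h t) Ω → (∀ v ∈ Ω, 0 < h t v) →
      ⟪x, (v : EuclideanSpace ℝ (Fin n))⟫ = gauge (wulffShape Ω (h t)) x * h t v := by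
    intro t
    by_cases ht : ContinuousOn (h t) Ω ∧ ∀ v ∈ Ω, 0 < h t v
    · obtain ⟨v, hv, hxv⟩ := exists_inner_eq_gauge_mul hΩ hne hΩ_hemi ht.1 ht.2 hx
      exact ⟨⟨v, hv⟩, fun _ _ => hxv⟩
    · exact ⟨⟨_, hv₀Ω⟩, fun h1 h2 => absurd ⟨h1, h2⟩ ht⟩
  choose w hw using hex
  have hgt : ∀ᶠ t in 𝓝[≠] (0 : ℝ), 0 < gauge (wulffShape Ω (h t)) x := by
    filter_upwards [h_cont, h_pos] with t h1 h2
    exact gauge_pos_of_ne_zero (isCompact_wulffShape hΩ hΩ_hemi h1)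
      (wulffShape_mem_nhds_zero hΩ hne h1 h2) hx
  have hup : ∀ᶠ t in 𝓝[≠] (0 : ℝ), q t ≤ h t v₀ / h₀ v₀ := by
    filter_upwards [h_cont, h_pos] with t h1 h2
    exact gauge_div_gauge_le hΩ hne hΩ_hemi h₀_pos h1 h2 hx hv₀Ω hv₀
  have hlow : ∀ᶠ t in 𝓝[≠] (0 : ℝ), h t (w t) / h₀ (w t) ≤ q t := by
    filter_upwards [h_cont, h_pos] with t h1 h2
    exact le_gauge_div_gauge hΩ hne hΩ_hemi h₀_cont h₀_pos h1 h2 hx (w t).2 (hw t h1 h2)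
  -- The selection s is arbitrary, so that both the moving w t and the fixed v₀ are covered; the
  -- difference quotients are eventually bounded by sup |F| + 1.
  have hratio : ∀ s : ℝ → Ω, Tendsto (fun t => h t (s t) / h₀ (s t)) (𝓝[≠] 0) (𝓝 1) := by
    intro s
    obtain ⟨M, hM⟩ := hΩ.isCompact.exists_bound_of_continuousOn F_cont
    have ht : Tendsto (fun t : ℝ => (M + 1) * |t|) (𝓝[≠] 0) (𝓝 0) := by
      have : Continuous fun t : ℝ => (M + 1) * |t| := by fun_prop
      have := this.tendsto 0
      simp only [abs_zero, mul_zero] at this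
      exact this.mono_left nhdsWithin_le_nhds
    rw [← tendsto_sub_nhds_zero_iff]
    refine squeeze_zero_norm' ?_ ht
    filter_upwards [Metric.tendstoUniformlyOn_iff.1 hF 1 one_pos, self_mem_nhdsWithin] with t h1 h2
    have h3 := h1 (s t) (s t).2
    rw [Real.dist_eq, abs_sub_comm] at h3
    have h4 := hM (s t) (s t).2
    have h5 : |(h t (s t) / h₀ (s t) - 1) / t| ≤ M + 1 := by
      have := abs_sub_abs_le_abs_sub ((h t (s t) / h₀ (s t) - 1) / t) (F (s t))
      rw [Real.norm_eq_abs] at h4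
      linarith
    rwa [abs_div, div_le_iff₀ (abs_pos.2 h2)] at h5
  have hq1 : Tendsto q (𝓝[≠] 0) (𝓝 1) :=
    tendsto_of_tendsto_of_tendsto_of_le_of_le' (hratio w) (hratio fun _ => ⟨v₀, hv₀Ω⟩) hlow hup
  refine ⟨hq1, ?_⟩
  -- Since ψ (w t) tends to the gauge of x, every cluster point of w is active for h₀ on this ray,
  -- hence equals v₀ by regularity. As Ω is compact, w converges.
  have hwlim : Tendsto w (𝓝[≠] 0) (𝓝 (⟨v₀, hv₀Ω⟩ : Ω)) := by
    refine tendsto_nhds_of_unique_mapClusterPt fun y hy => ?_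
    let ψ : Ω → ℝ := fun v => ⟪x, (v : EuclideanSpace ℝ (Fin n))⟫ / h₀ v
    have hψ : Continuous ψ := by
      refine Continuous.div (by fun_prop) (continuousOn_iff_continuous_domRestrict.1 h₀_cont)
        fun v => (h₀_pos v v.2).ne'
    have h1 : MapClusterPt (ψ y) (𝓝[≠] (0 : ℝ)) (ψ ∘ w) := hy.tendsto_comp hψ.continuousAt
    have h2 : Tendsto (ψ ∘ w) (𝓝[≠] (0 : ℝ)) (𝓝 (gauge (wulffShape Ω h₀) x)) := by
      have h3 := ((hratio w).div hq1 one_ne_zero).const_mul (gauge (wulffShape Ω h₀) x)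
      rw [div_one, mul_one] at h3
      refine h3.congr' ?_
      filter_upwards [h_cont, h_pos, hgt] with t h4 h5 h6
      have h7 := h₀_pos (w t) (w t).2
      simp only [ψ, Function.comp, hw t h4 h5, Pi.div_apply, hq]
      field_simp
    have h3 : ψ y = gauge (wulffShape Ω h₀) x := by
      have : ClusterPt (ψ y) (map (ψ ∘ w) (𝓝[≠] (0 : ℝ))) := h1
      have h4 := this.mono h2
      exact eq_of_nhds_neBot h4
    refine Subtype.ext (huniq y ?_)
    have h4 := h₀_pos y y.2
    refine mem_supportHyperplane_of_inner_eq hK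
      ((isClosed_wulffShape Ω h₀).frontier_subset hreg.1) y.2 ?_
    rw [real_inner_smul_left, inv_mul_eq_iff_eq_mul₀ hg.ne']
    rwa [div_eq_iff h4.ne'] at h3
  have hwlim' : Tendsto (fun t => (w t : Metric.sphere (0 : EuclideanSpace ℝ (Fin n)) 1))
      (𝓝[≠] 0) (𝓝[Ω] v₀) :=
    tendsto_nhdsWithin_iff.2 ⟨(continuous_subtype_val.tendsto _).comp hwlim,
      Filter.Eventually.of_forall fun t => (w t).2⟩
  -- Uniform convergence and continuity of F allow the quotient to be evaluated at the moving point
  -- w t.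
  have hD1 := hF.tendstoLocallyUniformlyOn.tendsto_comp (F_cont v₀ hv₀Ω) hv₀Ω hwlim'
  have hD2 := hF.tendsto_at hv₀Ω
  rw [← tendsto_sub_nhds_zero_iff] at hD1 hD2 ⊢
  have hsum := hD1.abs.add hD2.abs
  rw [abs_zero, add_zero] at hsum
  refine squeeze_zero_norm' ?_ hsum
  filter_upwards [hup, hlow, self_mem_nhdsWithin] with t h1 h2 h3
  rw [Real.norm_eq_abs]
  -- Dividing by a negative t exchanges the two bounds; the sum of the two absolute errors dominates
  -- in either case.
  rcases lt_or_gt_of_ne (show t ≠ 0 from h3) with ht | ht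
  · have a1 := div_le_div_of_nonpos_of_le ht.le (sub_le_sub_right h1 1)
    have a2 := div_le_div_of_nonpos_of_le ht.le (sub_le_sub_right h2 1)
    rw [abs_le]
    constructor
    · have := neg_abs_le ((h t v₀ / h₀ v₀ - 1) / t - F v₀)
      have := abs_nonneg ((h t (w t) / h₀ (w t) - 1) / t - F v₀)
      linarith
    · have := le_abs_self ((h t (w t) / h₀ (w t) - 1) / t - F v₀)
      have := abs_nonneg ((h t v₀ / h₀ v₀ - 1) / t - F v₀)
      linarith
  · have a1 := div_le_div_of_nonneg_right (sub_le_sub_right h1 1) ht.le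
    have a2 := div_le_div_of_nonneg_right (sub_le_sub_right h2 1) ht.le
    rw [abs_le]
    constructor
    · have := neg_abs_le ((h t (w t) / h₀ (w t) - 1) / t - F v₀)
      have := abs_nonneg ((h t v₀ / h₀ v₀ - 1) / t - F v₀)
      linarith
    · have := le_abs_self ((h t v₀ / h₀ v₀ - 1) / t - F v₀)
      have := abs_nonneg ((h t (w t) / h₀ (w t) - 1) / t - F v₀)
      linarith

/-- A uniform bound for the difference quotients of the ratio of the gauges. -/
theorem eventually_abs_gauge_ratio_sub_one_le (hΩ : IsClosed Ω) (hne : Ω.Nonempty)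
    (hΩ_hemi : ∀ u : Metric.sphere (0 : EuclideanSpace ℝ (Fin n)) 1, ¬ Ω ⊆ closedHemisphere u)
    {h₀ F : Metric.sphere (0 : EuclideanSpace ℝ (Fin n)) 1 → ℝ}
    (h₀_cont : ContinuousOn h₀ Ω) (h₀_pos : ∀ v ∈ Ω, 0 < h₀ v) (F_cont : ContinuousOn F Ω)
    {h : ℝ → Metric.sphere (0 : EuclideanSpace ℝ (Fin n)) 1 → ℝ}
    (h_cont : ∀ᶠ t in 𝓝[≠] (0 : ℝ), ContinuousOn (h t) Ω)
    (h_pos : ∀ᶠ t in 𝓝[≠] (0 : ℝ), ∀ v ∈ Ω, 0 < h t v)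
    (hF : TendstoUniformlyOn (fun t v => (h t v / h₀ v - 1) / t) F (𝓝[≠] (0 : ℝ)) Ω) :
    ∃ M : ℝ, 0 < M ∧ ∀ᶠ t in 𝓝[≠] (0 : ℝ), ∀ x, x ≠ 0 →
      |gauge (wulffShape Ω h₀) x / gauge (wulffShape Ω (h t)) x - 1| ≤ M * |t| := by
  obtain ⟨M, hM⟩ := hΩ.isCompact.exists_bound_of_continuousOn F_cont
  have hM0 : 0 ≤ M := by
    obtain ⟨v, hv⟩ := hne
    exact (norm_nonneg _).trans (hM v hv)
  refine ⟨M + 1, by linarith, ?_⟩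
  filter_upwards [h_cont, h_pos, Metric.tendstoUniformlyOn_iff.1 hF 1 one_pos,
    self_mem_nhdsWithin] with t h1 h2 h3 h4 x hx
  have hb : ∀ v ∈ Ω, |h t v / h₀ v - 1| ≤ (M + 1) * |t| := by
    intro v hv
    have h5 := h3 v hv
    rw [Real.dist_eq, abs_sub_comm] at h5
    have h6 := hM v hv
    rw [Real.norm_eq_abs] at h6
    have h7 := abs_sub_abs_le_abs_sub ((h t v / h₀ v - 1) / t) (F v)
    have h8 : |(h t v / h₀ v - 1) / t| ≤ M + 1 := by linarith
    rwa [abs_div, div_le_iff₀ (abs_pos.2 h4)] at h8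
  obtain ⟨v, hv, hxv⟩ := exists_inner_eq_gauge_mul hΩ hne hΩ_hemi h₀_cont h₀_pos hx
  obtain ⟨w, hw, hxw⟩ := exists_inner_eq_gauge_mul hΩ hne hΩ_hemi h1 h2 hx
  have u1 := gauge_div_gauge_le hΩ hne hΩ_hemi h₀_pos h1 h2 hx hv hxv
  have u2 := le_gauge_div_gauge hΩ hne hΩ_hemi h₀_cont h₀_pos h1 h2 hx hw hxw
  have b1 := abs_le.1 (hb v hv)
  have b2 := abs_le.1 (hb w hw)
  exact abs_le.2 ⟨by linarith, by linarith⟩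

/-- The derivative of the volume of Wulff shapes as an integral over the body. -/
theorem tendsto_volume_wulffShape_sub_div (hn : 1 ≤ n) (hΩ : IsClosed Ω)
    (hΩ_hemi : ∀ u : Metric.sphere (0 : EuclideanSpace ℝ (Fin n)) 1, ¬ Ω ⊆ closedHemisphere u)
    {h₀ F : Metric.sphere (0 : EuclideanSpace ℝ (Fin n)) 1 → ℝ}
    (h₀_cont : ContinuousOn h₀ Ω) (h₀_pos : ∀ v ∈ Ω, 0 < h₀ v) (F_cont : ContinuousOn F Ω)
    {h : ℝ → Metric.sphere (0 : EuclideanSpace ℝ (Fin n)) 1 → ℝ}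
    (h_cont : ∀ᶠ t in 𝓝[≠] (0 : ℝ), ContinuousOn (h t) Ω)
    (h_pos : ∀ᶠ t in 𝓝[≠] (0 : ℝ), ∀ v ∈ Ω, 0 < h t v)
    (hF : TendstoUniformlyOn (fun t v => (h t v / h₀ v - 1) / t) F (𝓝[≠] (0 : ℝ)) Ω)
    (z₀ : regularBoundary (wulffShape Ω h₀)) :
    Tendsto (fun t : ℝ => ((volume (wulffShape Ω (h t))).toReal -
        (volume (wulffShape Ω h₀)).toReal) / t) (𝓝[≠] (0 : ℝ))
      (𝓝 (∫ x in wulffShape Ω h₀, n * F (gaussMap _ (radialProj _ z₀ x)))) := by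
  have : Nonempty (Fin n) := ⟨⟨0, hn⟩⟩
  have hne := nonempty_of_not_subset_hemisphere hn hΩ_hemi
  have hK := isCompact_wulffShape hΩ hΩ_hemi h₀_cont
  have hc := convex_wulffShape Ω h₀
  have h0 := wulffShape_mem_nhds_zero hΩ hne h₀_cont h₀_pos
  have hs := exists_mem_supportHyperplane_wulffShape hΩ hne hΩ_hemi h₀_cont
  have hae0 : ∀ᵐ x : EuclideanSpace ℝ (Fin n), x ≠ 0 :=
    compl_mem_ae_iff.2 (measure_singleton 0)
  have hKfin : volume (wulffShape Ω h₀) ≠ ∞ := hK.measure_lt_top.ne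
  set q : ℝ → EuclideanSpace ℝ (Fin n) → ℝ := fun t x =>
    gauge (wulffShape Ω h₀) x / gauge (wulffShape Ω (h t)) x with hq
  obtain ⟨M, hM0, hM⟩ := eventually_abs_gauge_ratio_sub_one_le hΩ hne hΩ_hemi h₀_cont h₀_pos
    F_cont h_cont h_pos hF
  -- This forces q t x ≤ 2, the range in which `abs_pow_sub_one_le` applies.
  have hsmall : ∀ᶠ t in 𝓝[≠] (0 : ℝ), M * |t| ≤ 1 := by
    have : Continuous fun t : ℝ => M * |t| := by fun_prop
    have h1 : ∀ᶠ t in 𝓝 (0 : ℝ), M * |t| < 1 :=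
      this.continuousAt.eventually_lt continuousAt_const (by simp)
    exact (h1.filter_mono nhdsWithin_le_nhds).mono fun t ht => ht.le
  have hmeas : ∀ᶠ t in 𝓝[≠] (0 : ℝ), Measurable (q t) := by
    filter_upwards [h_cont, h_pos] with t h1 h2
    exact (continuous_gauge hc h0).measurable.div (continuous_gauge (convex_wulffShape Ω (h t))
      (wulffShape_mem_nhds_zero hΩ hne h1 h2)).measurable
  have hbound : ∀ᶠ t in 𝓝[≠] (0 : ℝ), ∀ x, x ≠ 0 → |q t x ^ n - 1| ≤ M * |t| * (n * 2 ^ n) := by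
    filter_upwards [hM, hsmall] with t h1 h2 x hx
    have h3 := h1 x hx
    refine (abs_pow_sub_one_le n (div_nonneg (gauge_nonneg _) (gauge_nonneg _)) ?_).trans
      (mul_le_mul_of_nonneg_right h3 (by positivity))
    have := (abs_le.1 h3).2
    linarith
  have hint : ∀ᶠ t in 𝓝[≠] (0 : ℝ), IntegrableOn (fun x => q t x ^ n - 1) (wulffShape Ω h₀) := by
    filter_upwards [hbound, hmeas] with t h1 h2
    refine Measure.integrableOn_of_bounded hKfin
      ((h2.pow_const n).sub_const 1).aestronglyMeasurable (M := M * |t| * (n * 2 ^ n)) ?_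
    exact ae_restrict_of_ae (hae0.mono fun x hx => h1 x hx)
  have hlim : Tendsto (fun t => ∫ x in wulffShape Ω h₀, (q t x ^ n - 1) / t) (𝓝[≠] (0 : ℝ))
      (𝓝 (∫ x in wulffShape Ω h₀, n * F (gaussMap _ (radialProj _ z₀ x)))) := by
    refine tendsto_integral_filter_of_dominated_convergence (fun _ => M * (n * 2 ^ n)) ?_ ?_ ?_ ?_
    · filter_upwards [hmeas] with t h1
      exact (((h1.pow_const n).sub_const 1).div_const t).aestronglyMeasurable
    · filter_upwards [hbound, self_mem_nhdsWithin] with t h1 h2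
      refine ae_restrict_of_ae (hae0.mono fun x hx => ?_)
      rw [Real.norm_eq_abs, abs_div, div_le_iff₀ (abs_pos.2 h2)]
      refine (h1 x hx).trans (le_of_eq (by ring))
    · exact integrableOn_const hKfin
    · refine ae_restrict_of_ae ?_
      filter_upwards [hae0, ae_inv_gauge_smul_mem_regularBoundary hK hc h0 hs] with x hx hr
      have hreg := hr hx
      have hp : radialProj (wulffShape Ω h₀) z₀ x = ⟨_, hreg⟩ := dif_pos hreg
      obtain ⟨l1, l2⟩ := tendsto_gauge_ratio_sub_one_div hΩ hne hΩ_hemi h₀_cont h₀_pos F_cont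
        h_cont h_pos hF hx hreg
      rw [hp]
      exact tendsto_pow_sub_one_div n l1 l2
  refine hlim.congr' ?_
  filter_upwards [hint, h_cont, h_pos] with t h1 h2 h3
  rw [volume_wulffShape_toReal hn hΩ hΩ_hemi h₀_cont h₀_pos h2 h3, integral_div]
  congr 1
  have h4 : IntegrableOn (fun _ : EuclideanSpace ℝ (Fin n) => (1 : ℝ)) (wulffShape Ω h₀) :=
    integrableOn_const hKfin
  have h5 : IntegrableOn (fun x => q t x ^ n) (wulffShape Ω h₀) := by
    have := h1.add h4
    refine this.congr (Filter.Eventually.of_forall fun x => ?_)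
    simp
  rw [integral_sub h5 h4]
  simp [Measure.real, hq]

/-- Integration against the surface area measure of a Wulff shape, in terms of the body. -/
theorem integral_surfaceAreaMeasure_wulffShape (hn : 1 ≤ n) (hΩ : IsClosed Ω)
    (hΩ_hemi : ∀ u : Metric.sphere (0 : EuclideanSpace ℝ (Fin n)) 1, ¬ Ω ⊆ closedHemisphere u)
    {h₀ f : Metric.sphere (0 : EuclideanSpace ℝ (Fin n)) 1 → ℝ}
    (h₀_cont : ContinuousOn h₀ Ω) (h₀_pos : ∀ v ∈ Ω, 0 < h₀ v) (f_cont : ContinuousOn f Ω) :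
    ∃ z₀ : regularBoundary (wulffShape Ω h₀),
      IntegrableOn f Ω (surfaceAreaMeasure (wulffShape Ω h₀)) ∧
      ∫ v in Ω, f v ∂(surfaceAreaMeasure (wulffShape Ω h₀)) =
        ∫ x in wulffShape Ω h₀, n * (f (gaussMap _ (radialProj _ z₀ x)) /
          h₀ (gaussMap _ (radialProj _ z₀ x))) := by
  have : Nonempty (Fin n) := ⟨⟨0, hn⟩⟩
  have hnpos : (0 : ℝ) < n := by exact_mod_cast hn
  have hne := nonempty_of_not_subset_hemisphere hn hΩ_hemi
  have hK := isCompact_wulffShape hΩ hΩ_hemi h₀_cont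
  have hc := convex_wulffShape Ω h₀
  have h0 := wulffShape_mem_nhds_zero hΩ hne h₀_cont h₀_pos
  have hs := exists_mem_supportHyperplane_wulffShape hΩ hne hΩ_hemi h₀_cont
  have hae0 : ∀ᵐ x : EuclideanSpace ℝ (Fin n), x ≠ 0 :=
    compl_mem_ae_iff.2 (measure_singleton 0)
  have hae := ae_inv_gauge_smul_mem_regularBoundary hK hc h0 hs
  obtain ⟨x₁, hx₁, hx₂⟩ := (hae0.and hae).exists
  let z₀ : regularBoundary (wulffShape Ω h₀) := ⟨_, hx₂ hx₁⟩
  have hμ := euclideanHausdorffMeasure_regularBoundary hn hK hc h0 hs z₀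
  have hpm := measurable_radialProj hc h0 (measurableSet_regularBoundary hK hs) z₀
  have hνc := continuous_gaussMap hK
  have hνm := hνc.measurable
  have hKfin : IsFiniteMeasure (volume.restrict (wulffShape Ω h₀)) :=
    ⟨by rw [Measure.restrict_apply_univ]; exact hK.measure_lt_top⟩
  have hden : Measurable fun z : regularBoundary (wulffShape Ω h₀) =>
      ENNReal.ofReal (n / ⟪(z : EuclideanSpace ℝ (Fin n)),
        (gaussMap _ z : EuclideanSpace ℝ (Fin n))⟫) := by
    have : Continuous fun z : regularBoundary (wulffShape Ω h₀) =>
        ⟪(z : EuclideanSpace ℝ (Fin n)), (gaussMap _ z : EuclideanSpace ℝ (Fin n))⟫ := by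
      fun_prop
    exact (this.measurable.const_div _).ennreal_ofReal
  -- K contains a ball of radius r about 0, so the density against the finite cone measure is at
  -- most n / r.
  have hfin : IsFiniteMeasure (μHE[n - 1] : Measure (regularBoundary (wulffShape Ω h₀))) := by
    obtain ⟨r, hr, hrK⟩ := exists_pos_le_inner_of_normal h0
    refine ⟨?_⟩
    rw [hμ, withDensity_apply _ MeasurableSet.univ, Measure.restrict_univ]
    refine (lintegral_mono (g := fun _ => ENNReal.ofReal (n / r)) fun z =>
      ENNReal.ofReal_le_ofReal (div_le_div_of_nonneg_left hnpos.le hr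
        (hrK _ _ fun y hy => inner_gaussMap_le hK z hy))).trans_lt ?_
    rw [lintegral_const]
    exact ENNReal.mul_lt_top ENNReal.ofReal_lt_top (measure_lt_top _ _)
  have hSfin : IsFiniteMeasure (surfaceAreaMeasure (wulffShape Ω h₀)) := by
    unfold surfaceAreaMeasure
    infer_instance
  refine ⟨z₀, f_cont.integrableOn_compact hΩ.isCompact, ?_⟩
  -- Only the restriction of f to Ω is known to be continuous; the indicator is measurable
  -- everywhere, as the change of variables needs.
  have hind : Measurable (Ω.indicator f) := by
    classical
    have := f_cont.measurable_piecewise (continuousOn_const (c := (0 : ℝ)) (s := Ωᶜ))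
      hΩ.measurableSet
    exact piecewise_eq_indicator (s := Ω) (f := f) ▸ this
  rw [← integral_indicator hΩ.measurableSet, surfaceAreaMeasure,
    integral_map hνm.aemeasurable hind.aestronglyMeasurable, hμ,
    integral_withDensity_eq_integral_toReal_smul hden
      (Filter.Eventually.of_forall fun _ => ENNReal.ofReal_lt_top)]
  refine (integral_map hpm.aemeasurable (Measurable.aestronglyMeasurable
    (hden.ennreal_toReal.smul (hind.comp hνm)))).trans ?_
  congr with x
  simp only [Pi.smul_apply', Function.comp]
  obtain ⟨hz1, hz2⟩ := gaussMap_wulffShape hΩ hne hΩ_hemi h₀_cont (radialProj _ z₀ x)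
  rw [hz2, indicator_of_mem hz1, ENNReal.toReal_ofReal (div_nonneg hnpos.le (h₀_pos _ hz1).le),
    smul_eq_mul]
  ring

end

end WulffShape

/-! ### The variational formula -/

theorem lemma4p9 (n : ℕ) (hn : 1 ≤ n)
    (Ω : Set (Metric.sphere (0 : EuclideanSpace ℝ (Fin n)) 1))
    (hΩ : IsClosed Ω)
    (hΩ_hemi : ∀ u : Metric.sphere (0 : EuclideanSpace ℝ (Fin n)) 1,
      ¬ Ω ⊆ WulffShape.closedHemisphere u)
    (h₀ f : Metric.sphere (0 : EuclideanSpace ℝ (Fin n)) 1 → ℝ)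
    (h₀_pos : ∀ v ∈ Ω, 0 < h₀ v)
    (h₀_cont : ContinuousOn h₀ Ω)
    (f_cont : ContinuousOn f Ω)
    (δ₀ : ℝ) (hδ₀ : 0 < δ₀)
    (h o : ℝ → Metric.sphere (0 : EuclideanSpace ℝ (Fin n)) 1 → ℝ)
    (h_pos : ∀ t ∈ Set.Ioo (-δ₀) δ₀, ∀ v ∈ Ω, 0 < h t v)
    (h_eq : ∀ t ∈ Set.Ioo (-δ₀) δ₀, ∀ v ∈ Ω, h t v = h₀ v + t * f v + o t v)
    (o_cont : ∀ t ∈ Set.Ioo (-δ₀) δ₀, ContinuousOn (o t) Ω)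
    (o_small : TendstoUniformlyOn (fun t v => o t v / t) (fun _ => 0) (𝓝[≠] (0 : ℝ)) Ω) :
    IntegrableOn f Ω (WulffShape.surfaceAreaMeasure (WulffShape.wulffShape Ω h₀)) ∧
    Tendsto
      (fun t : ℝ =>
        ((volume (WulffShape.wulffShape Ω (h t))).toReal -
          (volume (WulffShape.wulffShape Ω h₀)).toReal) / t)
      (𝓝[≠] (0 : ℝ))
      (𝓝 (∫ v in Ω, f v
        ∂(WulffShape.surfaceAreaMeasure (WulffShape.wulffShape Ω h₀)))) := by
  obtain ⟨z₀, hint, heq⟩ := WulffShape.integral_surfaceAreaMeasure_wulffShape hn hΩ hΩ_hemi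
    h₀_cont h₀_pos f_cont
  refine ⟨hint, ?_⟩
  rw [heq]
  have hev : ∀ᶠ t in 𝓝[≠] (0 : ℝ), t ∈ Set.Ioo (-δ₀) δ₀ :=
    nhdsWithin_le_nhds (Ioo_mem_nhds (neg_lt_zero.2 hδ₀) hδ₀)
  -- Here F = f / h₀. The quotients (h t / h₀ - 1) / t differ from it by (o t / t) / h₀, which is
  -- uniformly small since h₀ has a positive minimum on Ω.
  refine WulffShape.tendsto_volume_wulffShape_sub_div hn hΩ hΩ_hemi h₀_cont h₀_pos
    (f_cont.div h₀_cont fun v hv => (h₀_pos v hv).ne') ?_ (hev.mono h_pos) ?_ z₀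
  · filter_upwards [hev] with t ht
    exact ((h₀_cont.add (continuousOn_const.mul f_cont)).add (o_cont t ht)).congr (h_eq t ht)
  · obtain ⟨w, hw, hmin⟩ := hΩ.isCompact.exists_isMinOn
      (WulffShape.nonempty_of_not_subset_hemisphere hn hΩ_hemi) h₀_cont
    have hw0 := h₀_pos w hw
    rw [Metric.tendstoUniformlyOn_iff] at o_small ⊢
    intro ε hε
    filter_upwards [o_small (ε * h₀ w) (mul_pos hε hw0), hev, self_mem_nhdsWithin]
      with t h1 h2 h3 v hv
    have h4 := h1 v hv
    have h5 := h₀_pos v hv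
    have h6 : h₀ w ≤ h₀ v := hmin hv
    have h3' : t ≠ 0 := h3
    rw [Real.dist_eq, zero_sub, abs_neg] at h4
    have h7 : f v / h₀ v - (h t v / h₀ v - 1) / t = -(o t v / t / h₀ v) := by
      rw [h_eq t h2 v hv]
      field_simp
      ring
    rw [Real.dist_eq, Pi.div_apply, h7, abs_neg, abs_div, abs_of_pos h5, div_lt_iff₀ h5]
    exact h4.trans_le (mul_le_mul_of_nonneg_left h6 hε.le)
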